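/- **Setting.** Let $\rho$ be a density matrix on $\mathbb C^d\otimes\mathbb C^d$ with reduced states $\rho_A,\rho_B$, and write $\langle M\rangle_\rho=\operatorname{tr}(\rho M)$. For Hermitian observables $(M_\alpha)$, the covariance matrix of a state $\rho$ is $$\gamma(\rho,\{M_\alpha\})_{\alpha\beta}=\tfrac12\langle M_\alpha M_\beta+M_\beta M_\alpha\rangle_\rho-\langle M_\alpha\rangle_\rho\langle M_\beta\rangle_\rho .$$ Fix any two families $(A_i)_{i=1}^{d^2}$, $(B_j)_{j=1}^{d^2}$ of Hermitian $d\times d$ matrices with $\operatorname{tr}(A_iA_j)=\delta_{ij}=\operatorname{tr}(B_iB_j)$, and let $\gamma(\rho)$ be the covariance matrix of $\rho$ for the observables $\{A_i\otimes\mathbb 1\}\cup\{\mathbb 1\otimes B_j\}$. Let $C_{AB}$ denote its off-diagonal block, $(C_{AB})_{ij}=\langle A_i\otimes B_j\rangle_\rho-\langle A_i\otimes\mathbb 1\rangle_\rho\langle \mathbb 1\otimes B_j\rangle_\rho$. Define $$V(\rho)=\max\{t\le 1:\ \gamma(\rho)-t\,(\kappa_A\oplus\kappa_B)\ge 0 \text{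 for some } \kappa_A,\kappa_B\},\qquad \mathcal E(\rho)=1-V(\rho),$$ where $(\kappa_A,\kappa_B)$ ranges over all pairs $\kappa_A=\sum_kp_k\,\gamma(|\psi_k\rangle\langle\psi_k|,\{A_i\})$, $\kappa_B=\sum_kp_k\,\gamma(|\phi_k\rangle\langle\phi_k|,\{B_j\})$ with $(p_k)$ a finite probability distribution and $\psi_k,\phi_k$ unit vectors of $\mathbb C^d$. The concurrence of a unit vector $\psi\in\mathbb C^d\otimes\mathbb C^d$ is $$C(\psi)=\sqrt{\tfrac{d}{d-1}}\,\sqrt{1-\operatorname{tr}\rho_A^2},\qquad \rho_A=\operatorname{tr}_B|\psi\rangle\langle\psi| ,$$ and the concurrence of a state $\rho$ is the convex roof $C(\rho)=\min\sum_ip_iC(\psi_i)$ over all finite decompositions $\rho=\sum_ip_i|\psi_i\rangle\langle\psi_i|$ with $(p_i)$ a probability distribution and $\psi_i$ unit vectors. Write $\mathcal E(\psi)=\mathcal E(|\psi\rangle\langle\psi|)$, and let $\|\cdot\|_{\rm tr}$ be the trace norm (the sum of the singular values). **Statement.** 1. ($d=2$) $\mathcal E(\psi)=C(\psi)$ for every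 unit vector $\psi\in\mathbb C^2\otimes\mathbb C^2$, and $C(\rho)\ge\mathcal E(\rho)$ for every state $\rho$ on $\mathbb C^2\otimes\mathbb C^2$. 2. ($d=3$) $C(\psi)\ge\tfrac12\mathcal E(\psi)$ for every unit vector $\psi\in\mathbb C^3\otimes\mathbb C^3$; and for every state $\rho$ on $\mathbb C^3\otimes\mathbb C^3$ one has $C(\rho)\ge\tfrac12\mathcal E(\rho)$ and $$C(\rho)\ \ge\ \frac14\left\{\frac{\operatorname{tr}\rho_A^2+\operatorname{tr}\rho_B^2-2}{2}+\sqrt{\tfrac14\big[\operatorname{tr}\rho_A^2-\operatorname{tr}\rho_B^2\big]^2+\|C_{AB}\|_{\rm tr}^2}\right\}.$$ 3. ($d=4$) $C(\psi)\ge\tfrac13\mathcal E(\psi)$ for every unit vector $\psi\in\mathbb C^4\otimes\mathbb C^4$, and $C(\rho)\ge\tfrac13\mathcal E(\rho)$ for every state $\rho$ on $\mathbb C^4\otimes\mathbb C^4$. -/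

import Mathlib

open scoped Kronecker ComplexOrder

noncomputable section

namespace CovEnt

/-! ### States -/

/-- The Hilbert space `ℂ^a ⊗ ℂ^b`, in the product basis. -/
abbrev Bipartite (a b : ℕ) : Type := EuclideanSpace ℂ (Fin a × Fin b)

/-- The operator `|ψ⟩⟨ψ|`. -/
def ketBra {n : Type*} (ψ : EuclideanSpace ℂ n) : Matrix n n ℂ :=
  Matrix.of fun i j => ψ i * star (ψ j)

/-- Density matrices. -/
def IsState {n : Type*} [Fintype n] (ρ : Matrix n n ℂ) : Prop :=
  ρ.PosSemidef ∧ ρ.trace = 1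

/-- The reduced state `ρ_A = tr_B ρ`. -/
def reducedA {a b : ℕ} (ρ : Matrix (Fin a × Fin b) (Fin a × Fin b) ℂ) :
    Matrix (Fin a) (Fin a) ℂ :=
  Matrix.of fun i j => ∑ k, ρ (i, k) (j, k)

/-- The reduced state `ρ_B = tr_A ρ`. -/
def reducedB {a b : ℕ} (ρ : Matrix (Fin a × Fin b) (Fin a × Fin b) ℂ) :
    Matrix (Fin b) (Fin b) ℂ :=
  Matrix.of fun i j => ∑ k, ρ (k, i) (k, j)

/-- The purity `tr ρ²` (a real number for Hermitian `ρ`). -/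
def purity {n : Type*} [Fintype n] (ρ : Matrix n n ℂ) : ℝ := (ρ * ρ).trace.re

/-! ### Covariance matrices -/

/-- The mean value `⟨M⟩_ρ = tr (ρ M)` (a real number for Hermitian `ρ` and `M`). -/
def mean {n : Type*} [Fintype n] (ρ M : Matrix n n ℂ) : ℝ := (ρ * M).trace.re

/-- The covariance matrix
`γ(ρ)_{αβ} = ½ ⟨M_α M_β + M_β M_α⟩_ρ - ⟨M_α⟩_ρ ⟨M_β⟩_ρ` of the observables `M_α`. -/
def covMatrix {n ι : Type*} [Fintype n] (ρ : Matrix n n ℂ) (M : ι → Matrix n n ℂ) :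
    Matrix ι ι ℝ :=
  Matrix.of fun α β => 1 / 2 * mean ρ (M α * M β + M β * M α) - mean ρ (M α) * mean ρ (M β)

/-- A complete set of local orthogonal observables on `ℂ^d`: `d²` Hermitian matrices with
`tr (A_i A_j) = δ_{ij}`. -/
def IsLOO {d : ℕ} (A : Fin (d ^ 2) → Matrix (Fin d) (Fin d) ℂ) : Prop :=
  (∀ i, (A i).IsHermitian) ∧ ∀ i j, (A i * A j).trace = if i = j then 1 else 0

/-- The joint family of observables `A_i ⊗ 𝟙`, `𝟙 ⊗ B_j`. -/
def jointObs {a b : ℕ} (A : Fin (a ^ 2) → Matrix (Fin a) (Fin a) ℂ)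
    (B : Fin (b ^ 2) → Matrix (Fin b) (Fin b) ℂ) :
    Fin (a ^ 2) ⊕ Fin (b ^ 2) → Matrix (Fin a × Fin b) (Fin a × Fin b) ℂ :=
  Sum.elim (fun i => A i ⊗ₖ (1 : Matrix (Fin b) (Fin b) ℂ))
    (fun j => (1 : Matrix (Fin a) (Fin a) ℂ) ⊗ₖ B j)

/-- The correlation block `C_{ij} = ⟨A_i ⊗ B_j⟩ - ⟨A_i⟩ ⟨B_j⟩` of the covariance matrix. -/
def corrBlock {a b : ℕ} (A : Fin (a ^ 2) → Matrix (Fin a) (Fin a) ℂ)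
    (B : Fin (b ^ 2) → Matrix (Fin b) (Fin b) ℂ)
    (ρ : Matrix (Fin a × Fin b) (Fin a × Fin b) ℂ) :
    Matrix (Fin (a ^ 2)) (Fin (b ^ 2)) ℝ :=
  Matrix.of fun i j =>
    mean ρ (A i ⊗ₖ B j) - mean (reducedA ρ) (A i) * mean (reducedB ρ) (B j)

/-- The trace norm of a real matrix: the sum of its singular values. -/
def traceNorm {m n : ℕ} (M : Matrix (Fin m) (Fin n) ℝ) : ℝ :=
  ∑ i : Fin n, (Matrix.toEuclideanLin M).singularValues i

/-! ### The entanglement parameter -/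

/-- `κ_A = ∑ p_k γ(|ψ_k⟩⟨ψ_k|)` and `κ_B = ∑ p_k γ(|φ_k⟩⟨φ_k|)` for some convex weights `p_k` and
some pure states `ψ_k` of the first and `φ_k` of the second system. -/
def IsKappaPair {a b : ℕ} (A : Fin (a ^ 2) → Matrix (Fin a) (Fin a) ℂ)
    (B : Fin (b ^ 2) → Matrix (Fin b) (Fin b) ℂ)
    (κA : Matrix (Fin (a ^ 2)) (Fin (a ^ 2)) ℝ)
    (κB : Matrix (Fin (b ^ 2)) (Fin (b ^ 2)) ℝ) : Prop :=
  ∃ (K : ℕ) (p : Fin K → ℝ) (ψ : Fin K → EuclideanSpace ℂ (Fin a))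
    (φ : Fin K → EuclideanSpace ℂ (Fin b)),
    (∀ k, 0 ≤ p k) ∧ ∑ k, p k = 1 ∧ (∀ k, ‖ψ k‖ = 1) ∧ (∀ k, ‖φ k‖ = 1) ∧
    κA = ∑ k, p k • covMatrix (ketBra (ψ k)) A ∧
    κB = ∑ k, p k • covMatrix (ketBra (φ k)) B

/-- `V(ρ)`, the largest `t ≤ 1` with `γ(ρ) - t (κ_A ⊕ κ_B) ≥ 0` for some `κ_A`, `κ_B`. -/
def V {a b : ℕ} (A : Fin (a ^ 2) → Matrix (Fin a) (Fin a) ℂ)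
    (B : Fin (b ^ 2) → Matrix (Fin b) (Fin b) ℂ)
    (ρ : Matrix (Fin a × Fin b) (Fin a × Fin b) ℂ) : ℝ :=
  sSup {t : ℝ | t ≤ 1 ∧ ∃ κA κB, IsKappaPair A B κA κB ∧
    (covMatrix ρ (jointObs A B) - t • Matrix.fromBlocks κA 0 0 κB).PosSemidef}

/-- The entanglement parameter `𝓔(ρ) = 1 - V(ρ)`. -/
def entParam {a b : ℕ} (A : Fin (a ^ 2) → Matrix (Fin a) (Fin a) ℂ)
    (B : Fin (b ^ 2) → Matrix (Fin b) (Fin b) ℂ)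
    (ρ : Matrix (Fin a × Fin b) (Fin a × Fin b) ℂ) : ℝ :=
  1 - V A B ρ

/-! ### The concurrence -/

/-- The concurrence `√(d/(d-1)) √(1 - tr ρ_A²)` of a pure state of a `d × d` system. -/
def pureConcurrence {d : ℕ} (ψ : Bipartite d d) : ℝ :=
  √((d : ℝ) / ((d : ℝ) - 1)) * √(1 - purity (reducedA (ketBra ψ)))

/-- The concurrence of a mixed state: the convex roof of `pureConcurrence`. -/
def concurrence {d : ℕ} (ρ : Matrix (Fin d × Fin d) (Fin d × Fin d) ℂ) : ℝ :=
  sInf {c : ℝ | ∃ (N : ℕ) (p : Fin N → ℝ) (ψ : Fin N → Bipartite d d),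
    (∀ i, 0 ≤ p i) ∧ ∑ i, p i = 1 ∧ (∀ i, ‖ψ i‖ = 1) ∧
    ρ = ∑ i, (p i : ℂ) • ketBra (ψ i) ∧ c = ∑ i, p i * pureConcurrence (ψ i)}

end CovEnt

end

open CovEnt

open CovEnt

namespace CovEnt
open Matrix

/-! The quadratic form of a covariance matrix is a variance, so `γ(ρ) - t (κ_A ⊕ κ_B) ≥ 0` says that
the variance of every `X ⊗ 1 + 1 ⊗ Y` in `ρ` is at least `t` times an averaged sum of variances of
`X` and `Y` in pure local states.

Bounds on the concurrence from below need a feasible `t`. For a pure state with Schmidt coefficients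
`s`, take the product of the two local vectors belonging to the largest coefficient, with `t = (s i₀
- s j₀) ^ 2` the squared gap to the second largest. Feasibility is `sum_le_svar_schmidtState`.
Cauchy–Schwarz (`one_sub_sq_le`) gives `1 - t ≤ √((d + 2) / 2 * (1 - tr ρ_A²))`, a multiple of the
concurrence; `c = d - 1` is an admissible factor for `d = 2, 3, 4`. Concavity of the variance
carries the bound to any decomposition of a mixed state, hence to the convex roof.

Bounds on `𝓔` from below limit every feasible `t`. The diagonal blocks have traces depending only on
`t`, `d` and the purities, and the trace norm of the off-diagonal block is at most the geometric
mean of these traces (`traceNorm_sq_le`). For pure states, summing the variance inequality over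
anticorrelated pairs of observables gives `t (d - 1) ≤ d - (∑ s) ^ 2`, which for `d = 2` matches the
first bound. -/

/-- Singular value decomposition with full orthonormal bases. -/
theorem exists_singularValue_bases {𝕜 E F : Type*} [RCLike 𝕜]
    [NormedAddCommGroup E] [InnerProductSpace 𝕜 E] [FiniteDimensional 𝕜 E]
    [NormedAddCommGroup F] [InnerProductSpace 𝕜 F] [FiniteDimensional 𝕜 F]
    {n : ℕ} (hE : Module.finrank 𝕜 E = n) (hF : Module.finrank 𝕜 F = n) (T : E →ₗ[𝕜] F) :
    ∃ (v : OrthonormalBasis (Fin n) 𝕜 E) (u : OrthonormalBasis (Fin n) 𝕜 F),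
      ∀ i, T (v i) = (T.singularValues i : 𝕜) • u i := by
  set hT := T.isSymmetric_adjoint_comp_self
  set v := hT.eigenvectorBasis hE
  have hv : ∀ i j, inner 𝕜 (T (v i)) (T (v j)) =
      if i = j then ((T.singularValues i : 𝕜)) ^ 2 else 0 := by
    intro i j
    rw [← LinearMap.adjoint_inner_right, ← LinearMap.comp_apply,
      hT.apply_eigenvectorBasis hE j, inner_smul_right, orthonormal_iff_ite.mp v.orthonormal,
      ← T.sq_singularValues_fin hE]
    split_ifs with h
    · subst h; simp
    · simp
  -- Only the normalised images with nonzero singular value are orthonormal; the other basis vectors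
  -- may be arbitrary, since their coefficient vanishes.
  set w : Fin n → F := fun i => ((T.singularValues i : 𝕜))⁻¹ • T (v i)
  set s : Set (Fin n) := {i | T.singularValues i ≠ 0}
  have hw : Orthonormal 𝕜 (s.domRestrict w) := by
    rw [orthonormal_iff_ite]
    rintro ⟨i, hi⟩ ⟨j, hj⟩
    have hi' : (T.singularValues i : 𝕜) ≠ 0 := by exact_mod_cast hi
    simp only [Set.domRestrict_apply, w, inner_smul_left, inner_smul_right, hv, Subtype.mk.injEq]
    split_ifs with h
    · subst h
      simp only [map_inv₀, RCLike.conj_ofReal]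
      field_simp
    · simp
  obtain ⟨u, hu⟩ := hw.exists_orthonormalBasis_extension_of_card_eq (by simp [hF])
  refine ⟨v, u, fun i => ?_⟩
  by_cases h : T.singularValues i = 0
  · have := hv i i
    rw [h] at this
    simpa [h] using this
  · rw [hu i h]
    have h' : (T.singularValues i : 𝕜) ≠ 0 := by exact_mod_cast h
    simp [w, smul_smul, h']

/-! ### Mean values and variances -/

section Mean

variable {n : Type*} [Fintype n]

/-- The variance `⟨Z²⟩ - ⟨Z⟩²`. -/
noncomputable def svar (ρ Z : Matrix n n ℂ) : ℝ := mean ρ (Z * Z) - mean ρ Z ^ 2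

theorem mean_add (ρ X Y : Matrix n n ℂ) : mean ρ (X + Y) = mean ρ X + mean ρ Y := by
  simp [mean, mul_add]

theorem mean_smul (ρ : Matrix n n ℂ) (c : ℝ) (X : Matrix n n ℂ) :
    mean ρ (c • X) = c * mean ρ X := by
  simp [mean]

theorem mean_sum {ι : Type*} (ρ : Matrix n n ℂ) (s : Finset ι) (X : ι → Matrix n n ℂ) :
    mean ρ (∑ i ∈ s, X i) = ∑ i ∈ s, mean ρ (X i) := by
  simp [mean, Finset.mul_sum, trace_sum]

theorem mean_sum_smul_left {ι : Type*} (s : Finset ι) (p : ι → ℝ) (ρ : ι → Matrix n n ℂ)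
    (X : Matrix n n ℂ) :
    mean (∑ i ∈ s, (p i : ℂ) • ρ i) X = ∑ i ∈ s, p i * mean (ρ i) X := by
  simp [mean, Finset.sum_mul, trace_sum]

theorem mean_conj (V ρ Z : Matrix n n ℂ) : mean (V * ρ * Vᴴ) Z = mean ρ (Vᴴ * Z * V) := by
  unfold mean
  rw [Matrix.mul_assoc, Matrix.mul_assoc, trace_mul_comm]
  simp only [Matrix.mul_assoc]

theorem svar_conj [DecidableEq n] {V : Matrix n n ℂ} (hV : V * Vᴴ = 1) (ρ Z : Matrix n n ℂ) :
    svar (V * ρ * Vᴴ) Z = svar ρ (Vᴴ * Z * V) := by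
  have : Vᴴ * (Z * Z) * V = Vᴴ * Z * V * (Vᴴ * Z * V) := by
    calc _ = Vᴴ * Z * 1 * Z * V := by simp only [Matrix.mul_assoc, Matrix.one_mul]
      _ = _ := by rw [← hV]; simp only [Matrix.mul_assoc]
  simp only [svar, mean_conj, this]

/-- The covariance matrix is the matrix of the quadratic form given by the variance. -/
theorem dotProduct_covMatrix_mulVec {ι : Type*} [Fintype ι] (ρ : Matrix n n ℂ)
    (M : ι → Matrix n n ℂ) (v : ι → ℝ) :
    v ⬝ᵥ (covMatrix ρ M *ᵥ v) = svar ρ (∑ i, v i • M i) := by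
  have h1 : mean ρ ((∑ i, v i • M i) * ∑ i, v i • M i) =
      ∑ i, ∑ j, v i * v j * mean ρ (M i * M j) := by
    rw [Finset.sum_mul_sum, mean_sum]
    refine Finset.sum_congr rfl fun i _ => ?_
    rw [mean_sum]
    refine Finset.sum_congr rfl fun j _ => ?_
    rw [smul_mul_smul_comm, mean_smul]
  have h2 : ∑ i, ∑ j, v i * v j * mean ρ (M j * M i) = ∑ i, ∑ j, v i * v j * mean ρ (M i * M j) := by
    rw [Finset.sum_comm]
    exact Finset.sum_congr rfl fun i _ => Finset.sum_congr rfl fun j _ => by rw [mul_comm (v j)]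
  have h3 : mean ρ (∑ i, v i • M i) ^ 2 = ∑ i, ∑ j, v i * v j * (mean ρ (M i) * mean ρ (M j)) := by
    rw [mean_sum, sq, Finset.sum_mul_sum]
    simp only [mean_smul]
    refine Finset.sum_congr rfl fun i _ => Finset.sum_congr rfl fun j _ => by ring
  have h4 : v ⬝ᵥ (covMatrix ρ M *ᵥ v) = 1 / 2 * (∑ i, ∑ j, v i * v j * mean ρ (M i * M j)) +
      1 / 2 * (∑ i, ∑ j, v i * v j * mean ρ (M j * M i)) -
      ∑ i, ∑ j, v i * v j * (mean ρ (M i) * mean ρ (M j)) := by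
    simp only [dotProduct, mulVec, covMatrix, of_apply, Finset.mul_sum, ← Finset.sum_add_distrib,
      ← Finset.sum_sub_distrib, mean_add]
    refine Finset.sum_congr rfl fun i _ => Finset.sum_congr rfl fun j _ => by ring
  rw [h4, h2, svar, h1, h3]
  ring

theorem covMatrix_isHermitian {ι : Type*} (ρ : Matrix n n ℂ)
    (M : ι → Matrix n n ℂ) : (covMatrix ρ M).IsHermitian := by
  ext i j
  simp [covMatrix, add_comm, mul_comm (mean ρ (M j))]

theorem sq_sum_le_sum_mul_sq {ι : Type*} [Fintype ι] {p : ι → ℝ} (hp : ∀ i, 0 ≤ p i)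
    (h1 : ∑ i, p i = 1) (x : ι → ℝ) : (∑ i, p i * x i) ^ 2 ≤ ∑ i, p i * x i ^ 2 := by
  have h := (even_two.convexOn_pow : ConvexOn ℝ Set.univ fun x : ℝ => x ^ 2).map_sum_le
    (t := Finset.univ) (w := p) (p := x) (fun i _ => hp i) h1 (fun i _ => Set.mem_univ _)
  simpa [smul_eq_mul] using h

/-- The variance is concave in the state. -/
theorem sum_svar_le {ι : Type*} [Fintype ι] {p : ι → ℝ} (hp : ∀ i, 0 ≤ p i)
    (h1 : ∑ i, p i = 1) (ρ : ι → Matrix n n ℂ) (Z : Matrix n n ℂ) :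
    ∑ i, p i * svar (ρ i) Z ≤ svar (∑ i, (p i : ℂ) • ρ i) Z := by
  have := sq_sum_le_sum_mul_sq hp h1 fun i => mean (ρ i) Z
  simp only [svar, mul_sub, Finset.sum_sub_distrib, mean_sum_smul_left]
  linarith

end Mean

/-! ### Complete sets of local orthogonal observables -/

section LOO

variable {d : ℕ} {A : Fin (d ^ 2) → Matrix (Fin d) (Fin d) ℂ}

/-- Trace orthonormality forces linear independence, and `d ^ 2` is the dimension of the matrix
space. -/
theorem IsLOO.expansion (hA : IsLOO A) (X : Matrix (Fin d) (Fin d) ℂ) :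
    X = ∑ i, (A i * X).trace • A i := by
  have hli : LinearIndependent ℂ A := by
    rw [Fintype.linearIndependent_iff]
    intro g hg i
    have h := congrArg (fun Y => (A i * Y).trace) hg
    simpa [Finset.mul_sum, trace_sum, hA.2] using h
  have hsp : X ∈ Submodule.span ℂ (Set.range A) := by
    rw [hli.span_eq_top_of_card_eq_finrank' (by simp [Module.finrank_matrix, sq])]
    trivial
  obtain ⟨c, hc⟩ := (Submodule.mem_span_range_iff_exists_fun ℂ).mp hsp
  have : ∀ i, (A i * X).trace = c i := by
    intro i
    simp [← hc, Finset.mul_sum, trace_sum, hA.2]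
  simp only [this, hc]

theorem trace_mul_im_eq_zero {n : Type*} [Fintype n] {X Y : Matrix n n ℂ} (hX : X.IsHermitian)
    (hY : Y.IsHermitian) : (X * Y).trace.im = 0 := by
  have : star (X * Y).trace = (X * Y).trace := by
    rw [← trace_conjTranspose, conjTranspose_mul, hX.eq, hY.eq, trace_mul_comm]
  exact Complex.conj_eq_iff_im.mp this

theorem IsLOO.real_expansion (hA : IsLOO A) {X : Matrix (Fin d) (Fin d) ℂ} (hX : X.IsHermitian) :
    X = ∑ i, (A i * X).trace.re • A i := by
  conv_lhs => rw [hA.expansion X]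
  refine Finset.sum_congr rfl fun i _ => ?_
  have : (A i * X).trace = ((A i * X).trace.re : ℂ) :=
    Complex.ext rfl (by simp [trace_mul_im_eq_zero (hA.1 i) hX])
  rw [this]
  ext a b
  simp

/-- This is the completeness relation: `∑ A i ⊗ A i` is the swap operator whatever the choice of
`A`. It comes from expanding a matrix unit. -/
theorem IsLOO.sum_apply_mul_apply (hA : IsLOO A) (k l m n : Fin d) :
    ∑ i, A i l k * A i m n = if k = m ∧ l = n then 1 else 0 := by
  have h := congrFun (congrFun (hA.expansion (Matrix.single k l 1)) m) n
  simp only [Matrix.sum_apply, Matrix.smul_apply, smul_eq_mul, trace_mul_single,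
    Matrix.single_apply] at h
  rw [h]
  simp

theorem IsLOO.sum_mul_self (hA : IsLOO A) : ∑ i, A i * A i = (d : ℂ) • 1 := by
  ext m n
  simp only [Matrix.sum_apply, mul_apply, Matrix.smul_apply, smul_eq_mul]
  rw [Finset.sum_comm]
  simp only [hA.sum_apply_mul_apply]
  by_cases h : m = n
  · subst h; simp
  · simp [h]

theorem IsLOO.sum_mean_sq (hA : IsLOO A) {ρ : Matrix (Fin d) (Fin d) ℂ} (hρ : ρ.IsHermitian) :
    ∑ i, mean ρ (A i) ^ 2 = purity ρ := by
  have h : purity ρ = mean ρ ρ := rfl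
  rw [h]
  conv_rhs => rw [hA.real_expansion hρ]
  rw [mean_sum]
  refine Finset.sum_congr rfl fun i _ => ?_
  rw [← hA.real_expansion hρ, mean_smul, sq, trace_mul_comm]
  rfl

/-- The squares `A i * A i` sum to `d • 1`, and Parseval turns the squared means into the purity.
The total variance is thus independent of the choice of `A`, and equals `d - 1` on pure states. -/
theorem IsLOO.sum_svar (hA : IsLOO A) {ρ : Matrix (Fin d) (Fin d) ℂ} (hρ : ρ.IsHermitian)
    (h1 : ρ.trace = 1) : ∑ i, svar ρ (A i) = d - purity ρ := by
  simp only [svar, Finset.sum_sub_distrib, hA.sum_mean_sq hρ]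
  rw [← mean_sum, hA.sum_mul_self]
  simp [mean, h1]

theorem covMatrix_diag {n ι : Type*} [Fintype n] (ρ : Matrix n n ℂ) (M : ι → Matrix n n ℂ)
    (i : ι) : covMatrix ρ M i i = svar ρ (M i) := by
  simp only [covMatrix, of_apply, mean_add, svar]
  ring

theorem IsLOO.trace_covMatrix (hA : IsLOO A) {ρ : Matrix (Fin d) (Fin d) ℂ} (hρ : ρ.IsHermitian)
    (h1 : ρ.trace = 1) : (covMatrix ρ A).trace = d - purity ρ := by
  rw [← hA.sum_svar hρ h1]
  simp [trace, covMatrix_diag]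

theorem IsLOO.conj (hA : IsLOO A) {U : Matrix (Fin d) (Fin d) ℂ} (hU : U * Uᴴ = 1) :
    IsLOO fun i => Uᴴ * A i * U := by
  refine ⟨fun i => isHermitian_conjTranspose_mul_mul U (hA.1 i), fun i j => ?_⟩
  rw [← hA.2 i j]
  calc (Uᴴ * A i * U * (Uᴴ * A j * U)).trace = (Uᴴ * (A i * (U * Uᴴ) * A j * U)).trace := by
        simp only [Matrix.mul_assoc]
    _ = _ := by rw [trace_mul_comm, hU, Matrix.mul_one, Matrix.mul_assoc, hU, Matrix.mul_one]

/-- Supplies the anticorrelated partner observables used in `le_of_posSemidef_schmidt`. -/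
theorem IsLOO.neg_transpose (hA : IsLOO A) : IsLOO fun i => -(A i)ᵀ := by
  refine ⟨fun i => ((hA.1 i).transpose).neg, fun i j => ?_⟩
  rw [neg_mul_neg, ← transpose_mul, trace_transpose, trace_mul_comm, hA.2]

end LOO

/-! ### Pure states -/

section Pure

variable {n : Type*} [Fintype n]

theorem ketBra_isHermitian {n : Type*} (ψ : EuclideanSpace ℂ n) : (ketBra ψ).IsHermitian := by
  ext i j
  simp [ketBra, mul_comm]

theorem trace_ketBra {ψ : EuclideanSpace ℂ n} (h : ‖ψ‖ = 1) : (ketBra ψ).trace = 1 := by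
  have h2 : (∑ i, ‖ψ i‖ ^ 2 : ℝ) = 1 := by rw [← EuclideanSpace.norm_sq_eq, h]; simp
  have h3 := congrArg (fun x : ℝ => (x : ℂ)) h2
  simp only [Complex.ofReal_sum, Complex.ofReal_pow, Complex.ofReal_one] at h3
  simp only [trace, diag_apply, ketBra, of_apply, ← h3]
  exact Finset.sum_congr rfl fun i _ => Complex.mul_conj' _

theorem ketBra_mul_self {ψ : EuclideanSpace ℂ n} (h : ‖ψ‖ = 1) :
    ketBra ψ * ketBra ψ = ketBra ψ := by
  have h1 := trace_ketBra h
  simp only [trace, diag_apply, ketBra, of_apply] at h1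
  ext i j
  simp only [mul_apply, ketBra, of_apply]
  calc _ = ∑ k, (ψ i * star (ψ j)) * (ψ k * star (ψ k)) :=
        Finset.sum_congr rfl fun k _ => by ring
    _ = _ := by rw [← Finset.mul_sum, h1, mul_one]

theorem purity_ketBra {ψ : EuclideanSpace ℂ n} (h : ‖ψ‖ = 1) : purity (ketBra ψ) = 1 := by
  simp [purity, ketBra_mul_self h, trace_ketBra h]

theorem ketBra_posSemidef (ψ : EuclideanSpace ℂ n) : (ketBra ψ).PosSemidef :=
  posSemidef_vecMulVec_self_star (ψ : n → ℂ)

theorem ketBra_mulVec {m : Type*} (V : Matrix m n ℂ) (ψ : EuclideanSpace ℂ n)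
    (φ : EuclideanSpace ℂ m) (h : ∀ i, φ i = (V *ᵥ (ψ : n → ℂ)) i) :
    ketBra φ = V * ketBra ψ * Vᴴ := by
  have h1 : ketBra ψ = vecMulVec (ψ : n → ℂ) (star (ψ : n → ℂ)) := rfl
  have h2 : ketBra φ = vecMulVec (V *ᵥ (ψ : n → ℂ)) (star (V *ᵥ (ψ : n → ℂ))) := by
    ext i j
    simp [ketBra, vecMulVec_apply, h]
  rw [h1, h2, mul_vecMulVec, vecMulVec_mul, star_mulVec]

end Pure

/-! ### The joint covariance matrix -/

section Joint

variable {a b : ℕ}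

theorem mean_kronecker_one (ρ : Matrix (Fin a × Fin b) (Fin a × Fin b) ℂ)
    (X : Matrix (Fin a) (Fin a) ℂ) :
    mean ρ (X ⊗ₖ (1 : Matrix (Fin b) (Fin b) ℂ)) = mean (reducedA ρ) X := by
  unfold mean
  congr 1
  simp only [trace, diag_apply, mul_apply, reducedA, of_apply, kroneckerMap_apply,
    Fintype.sum_prod_type, one_apply, mul_ite, mul_one, mul_zero, Finset.sum_ite_eq',
    Finset.mem_univ, if_true, Finset.sum_mul]
  refine Finset.sum_congr rfl fun i _ => Finset.sum_comm

theorem mean_one_kronecker (ρ : Matrix (Fin a × Fin b) (Fin a × Fin b) ℂ)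
    (X : Matrix (Fin b) (Fin b) ℂ) :
    mean ρ ((1 : Matrix (Fin a) (Fin a) ℂ) ⊗ₖ X) = mean (reducedB ρ) X := by
  unfold mean
  congr 1
  have h : ∀ (i : Fin a) (k : Fin b), ∑ x : Fin a × Fin b,
      ρ (i, k) x * ((1 : Matrix (Fin a) (Fin a) ℂ) ⊗ₖ X) x (i, k) =
      ∑ k', ρ (i, k) (i, k') * X k' k := by
    intro i k
    rw [Fintype.sum_prod_type, Finset.sum_eq_single i]
    · simp
    · intro j _ hj
      simp [one_apply, hj]
    · simp
  simp only [trace, diag_apply, mul_apply, reducedB, of_apply, Finset.sum_mul]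
  rw [Fintype.sum_prod_type]
  simp only [h]
  rw [Finset.sum_comm]
  exact Finset.sum_congr rfl fun i _ => Finset.sum_comm

/-- Observables on different sides commute, so the symmetrisation is trivial in the off-diagonal
blocks. -/
theorem covMatrix_jointObs (A : Fin (a ^ 2) → Matrix (Fin a) (Fin a) ℂ)
    (B : Fin (b ^ 2) → Matrix (Fin b) (Fin b) ℂ)
    (ρ : Matrix (Fin a × Fin b) (Fin a × Fin b) ℂ) :
    covMatrix ρ (jointObs A B) = fromBlocks (covMatrix (reducedA ρ) A) (corrBlock A B ρ)
      (corrBlock A B ρ)ᵀ (covMatrix (reducedB ρ) B) := by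
  ext i j
  rcases i with i | i <;> rcases j with j | j
  · simp only [covMatrix, jointObs, of_apply, Sum.elim_inl, ← mul_kronecker_mul, ← add_kronecker,
      mul_one, mean_kronecker_one, fromBlocks_apply₁₁]
  · simp only [covMatrix, jointObs, of_apply, Sum.elim_inl, Sum.elim_inr, ← mul_kronecker_mul,
      mul_one, one_mul, mean_kronecker_one, mean_one_kronecker, fromBlocks_apply₁₂, mean_add,
      corrBlock]
    ring
  · simp only [covMatrix, jointObs, of_apply, Sum.elim_inl, Sum.elim_inr, ← mul_kronecker_mul,
      mul_one, one_mul, mean_kronecker_one, mean_one_kronecker, fromBlocks_apply₂₁, mean_add,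
      corrBlock, transpose_apply]
    ring
  · simp only [covMatrix, jointObs, of_apply, Sum.elim_inr, ← mul_kronecker_mul, ← kronecker_add,
      mul_one, mean_one_kronecker, fromBlocks_apply₂₂]

theorem sum_smul_jointObs (A : Fin (a ^ 2) → Matrix (Fin a) (Fin a) ℂ)
    (B : Fin (b ^ 2) → Matrix (Fin b) (Fin b) ℂ) (v : Fin (a ^ 2) ⊕ Fin (b ^ 2) → ℝ) :
    ∑ i, v i • jointObs A B i = (∑ i, v (.inl i) • A i) ⊗ₖ (1 : Matrix (Fin b) (Fin b) ℂ) +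
      (1 : Matrix (Fin a) (Fin a) ℂ) ⊗ₖ (∑ i, v (.inr i) • B i) := by
  rw [Fintype.sum_sum_type]
  congr 1
  · ext i j
    simp [jointObs, Matrix.sum_apply, Finset.sum_mul, mul_assoc]
  · ext i j
    simp only [jointObs, Matrix.sum_apply, Finset.mul_sum, Sum.elim_inr, Matrix.smul_apply, kroneckerMap_apply,
      mul_smul_comm]

/-- The quadratic form of `γ(ρ) - t (κ_A ⊕ κ_B)`. -/
theorem quadratic_form_sub {K : ℕ} (A : Fin (a ^ 2) → Matrix (Fin a) (Fin a) ℂ)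
    (B : Fin (b ^ 2) → Matrix (Fin b) (Fin b) ℂ)
    (ρ : Matrix (Fin a × Fin b) (Fin a × Fin b) ℂ) (t : ℝ) (p : Fin K → ℝ)
    (ψ : Fin K → EuclideanSpace ℂ (Fin a)) (φ : Fin K → EuclideanSpace ℂ (Fin b))
    (v : Fin (a ^ 2) ⊕ Fin (b ^ 2) → ℝ) :
    v ⬝ᵥ ((covMatrix ρ (jointObs A B) - t • fromBlocks
      (∑ k, p k • covMatrix (ketBra (ψ k)) A) 0 0 (∑ k, p k • covMatrix (ketBra (φ k)) B)) *ᵥ v) =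
    svar ρ ((∑ i, v (.inl i) • A i) ⊗ₖ (1 : Matrix (Fin b) (Fin b) ℂ) +
      (1 : Matrix (Fin a) (Fin a) ℂ) ⊗ₖ (∑ i, v (.inr i) • B i)) -
    t * ∑ k, p k * (svar (ketBra (ψ k)) (∑ i, v (.inl i) • A i) +
      svar (ketBra (φ k)) (∑ i, v (.inr i) • B i)) := by
  rw [← sum_smul_jointObs, ← dotProduct_covMatrix_mulVec]
  simp only [← dotProduct_covMatrix_mulVec]
  rw [sub_mulVec, dotProduct_sub, smul_mulVec, dotProduct_smul, fromBlocks_mulVec,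
    ← Sum.elim_comp_inl_inr v]
  simp only [zero_mulVec, add_zero, zero_add, sumElim_dotProduct_sumElim, sum_mulVec, smul_mulVec,
    dotProduct_sum, dotProduct_smul, smul_eq_mul, mul_add, Finset.sum_add_distrib]
  rfl

end Joint

/-! ### Schmidt decomposition -/

section Schmidt

variable {d : ℕ}

/-- The state `∑ s_k |kk⟩`. -/
noncomputable def schmidtState (s : Fin d → ℝ) : Bipartite d d :=
  WithLp.toLp 2 fun x => if x.1 = x.2 then (s x.1 : ℂ) else 0

/-- `ψ` has Schmidt coefficients `s` in the bases given by the columns of `U` and `W`. -/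
structure IsSchmidt (ψ : Bipartite d d) (s : Fin d → ℝ) (U W : Matrix (Fin d) (Fin d) ℂ) :
    Prop where
  nonneg : ∀ i, 0 ≤ s i
  left : U * Uᴴ = 1
  right : W * Wᴴ = 1
  apply : ∀ i j, ψ (i, j) = ∑ k, U i k * s k * W j k

theorem basis_matrix_unitary {𝕜 : Type*} [RCLike 𝕜]
    (u : OrthonormalBasis (Fin d) 𝕜 (EuclideanSpace 𝕜 (Fin d))) :
    (of fun i k => u k i)ᴴ * (of fun i k => u k i : Matrix (Fin d) (Fin d) 𝕜) = 1 := by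
  ext k l
  have h := orthonormal_iff_ite.mp u.orthonormal k l
  rw [PiLp.inner_apply] at h
  simp only [mul_apply, conjTranspose_apply, of_apply, one_apply, ← h]
  exact Finset.sum_congr rfl fun i _ => mul_comm _ _

theorem exists_isSchmidt (ψ : Bipartite d d) : ∃ s U W, IsSchmidt ψ s U W := by
  obtain ⟨v, u, h⟩ := exists_singularValue_bases (𝕜 := ℂ) (n := d) (by simp) (by simp)
    (toEuclideanLin (of fun i j => ψ (i, j) : Matrix (Fin d) (Fin d) ℂ))
  set T := toEuclideanLin (of fun i j => ψ (i, j) : Matrix (Fin d) (Fin d) ℂ)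
  -- The right basis is conjugated because the Schmidt form is bilinear, whereas `v.repr` conjugates
  -- its basis vectors.
  refine ⟨fun i => T.singularValues i, of fun i k => u k i, of fun i k => star (v k i),
    fun i => T.singularValues_nonneg i, ?_, ?_, fun i j => ?_⟩
  · rw [mul_eq_one_comm, basis_matrix_unitary]
  · have := congrArg transpose (basis_matrix_unitary v)
    rw [transpose_mul, transpose_one, mul_eq_one_comm] at this
    rw [← this]
    ext i j
    simp [mul_apply]
  · have h1 : ψ (i, j) = T (EuclideanSpace.single j 1) i := by
      simp [T, toLpLin_apply]
    rw [h1, ← v.sum_repr (EuclideanSpace.single j 1), map_sum]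
    simp only [map_smul, h, v.repr_apply_apply, EuclideanSpace.inner_single_right]
    simp only [WithLp.ofLp_sum, Finset.sum_apply, WithLp.ofLp_smul, Pi.smul_apply, smul_eq_mul]
    refine Finset.sum_congr rfl fun k _ => ?_
    simp only [one_mul, of_apply, RCLike.star_def, Complex.coe_algebraMap]
    ring

theorem kronecker_unitary {U W : Matrix (Fin d) (Fin d) ℂ} (hU : U * Uᴴ = 1) (hW : W * Wᴴ = 1) :
    (U ⊗ₖ W) * (U ⊗ₖ W)ᴴ = 1 := by
  rw [conjTranspose_kronecker, ← mul_kronecker_mul, hU, hW, one_kronecker_one]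

theorem conj_kronecker_add {U W : Matrix (Fin d) (Fin d) ℂ} (hU : U * Uᴴ = 1) (hW : W * Wᴴ = 1)
    (X Y : Matrix (Fin d) (Fin d) ℂ) :
    (U ⊗ₖ W)ᴴ * (X ⊗ₖ (1 : Matrix (Fin d) (Fin d) ℂ) + (1 : Matrix (Fin d) (Fin d) ℂ) ⊗ₖ Y) *
      (U ⊗ₖ W) = (Uᴴ * X * U) ⊗ₖ (1 : Matrix (Fin d) (Fin d) ℂ) +
        (1 : Matrix (Fin d) (Fin d) ℂ) ⊗ₖ (Wᴴ * Y * W) := by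
  rw [mul_eq_one_comm] at hU hW
  simp only [conjTranspose_kronecker, mul_add, add_mul, ← mul_kronecker_mul, mul_one, hU, hW]

section

variable {ψ : Bipartite d d} {s : Fin d → ℝ} {U W : Matrix (Fin d) (Fin d) ℂ}

theorem IsSchmidt.ketBra_eq (h : IsSchmidt ψ s U W) :
    ketBra ψ = (U ⊗ₖ W) * ketBra (schmidtState s) * (U ⊗ₖ W)ᴴ := by
  refine ketBra_mulVec _ _ _ ?_
  rintro ⟨i, j⟩
  simp only [h.apply, mulVec, dotProduct, Fintype.sum_prod_type, kroneckerMap_apply, schmidtState,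
    mul_ite, mul_zero, Finset.sum_ite_eq, Finset.mem_univ, if_true]
  exact Finset.sum_congr rfl fun k _ => by ring

theorem IsSchmidt.svar_eq (h : IsSchmidt ψ s U W) (X Y : Matrix (Fin d) (Fin d) ℂ) :
    svar (ketBra ψ) (X ⊗ₖ (1 : Matrix (Fin d) (Fin d) ℂ) +
      (1 : Matrix (Fin d) (Fin d) ℂ) ⊗ₖ Y) =
    svar (ketBra (schmidtState s)) ((Uᴴ * X * U) ⊗ₖ (1 : Matrix (Fin d) (Fin d) ℂ) +
        (1 : Matrix (Fin d) (Fin d) ℂ) ⊗ₖ (Wᴴ * Y * W)) := by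
  rw [h.ketBra_eq, svar_conj (kronecker_unitary h.left h.right),
    conj_kronecker_add h.left h.right]

theorem mean_schmidtState (s : Fin d → ℝ) (M : Matrix (Fin d × Fin d) (Fin d × Fin d) ℂ) :
    mean (ketBra (schmidtState s)) M = ∑ i, ∑ j, s i * s j * (M (j, j) (i, i)).re := by
  have h : (ketBra (schmidtState s) * M).trace =
      ∑ i, ∑ j, ((s i * s j : ℝ) : ℂ) * M (j, j) (i, i) := by
    simp only [trace, diag_apply, mul_apply, ketBra, of_apply, schmidtState,
      Fintype.sum_prod_type]
    refine Finset.sum_congr rfl fun i _ => ?_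
    rw [Finset.sum_eq_single i]
    · refine Finset.sum_congr rfl fun j _ => ?_
      rw [Finset.sum_eq_single j]
      · simp
      · intro k _ hk
        simp [hk.symm]
      · simp
    · intro k _ hk
      simp [hk.symm]
    · simp
  simp only [mean, h, Complex.re_sum, Complex.re_ofReal_mul]

theorem IsSchmidt.sum_sq (h : IsSchmidt ψ s U W) (hψ : ‖ψ‖ = 1) : ∑ i, s i ^ 2 = 1 := by
  have h1 : mean (ketBra ψ) 1 = 1 := by simp [mean, trace_ketBra hψ]
  have h2 : (U ⊗ₖ W)ᴴ * (U ⊗ₖ W) = 1 := mul_eq_one_comm.mp (kronecker_unitary h.left h.right)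
  rw [h.ketBra_eq, mean_conj, Matrix.mul_one, h2, mean_schmidtState] at h1
  rw [← h1]
  refine Finset.sum_congr rfl fun i _ => ?_
  rw [Finset.sum_eq_single i]
  · simp [sq]
  · intro j _ hj
    simp [hj]
  · simp

theorem IsSchmidt.purity_eq (h : IsSchmidt ψ s U W) :
    purity (reducedA (ketBra ψ)) = ∑ i, s i ^ 4 := by
  set D : Matrix (Fin d) (Fin d) ℂ := diagonal fun i => (s i : ℂ) with hD
  have hDD : D * D * (D * D) = diagonal fun i => ((s i ^ 4 : ℝ) : ℂ) := by
    simp only [hD, diagonal_mul_diagonal]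
    congr 1
    ext i
    push_cast
    ring
  have hDs : Dᴴ = D := by
    simp only [hD, diagonal_conjTranspose]
    congr 1
    ext i
    simp
  -- `P` is the coefficient matrix of `ψ`, so the reduced state is `P * Pᴴ = U * (D * D) * Uᴴ`.
  set P : Matrix (Fin d) (Fin d) ℂ := U * D * Wᵀ with hP
  have hψ : ∀ i j, ψ (i, j) = P i j := by
    intro i j
    simp [h.apply, hP, mul_apply, hD, diagonal_apply]
  have hW : Wᵀ * Wᵀᴴ = 1 := by
    have := congrArg transpose (mul_eq_one_comm.mp h.right)
    rwa [transpose_mul, transpose_one] at this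
  have hr : reducedA (ketBra ψ) = U * (D * D) * Uᴴ := by
    have : reducedA (ketBra ψ) = P * Pᴴ := by
      ext i j
      simp [reducedA, ketBra, hψ, mul_apply]
    rw [this, hP]
    simp only [conjTranspose_mul, hDs]
    calc _ = U * D * (Wᵀ * Wᵀᴴ) * D * Uᴴ := by simp only [Matrix.mul_assoc]
      _ = _ := by rw [hW]; simp only [Matrix.mul_assoc, Matrix.mul_one]
  have hU := mul_eq_one_comm.mp h.left
  have : (reducedA (ketBra ψ) * reducedA (ketBra ψ)).trace = (D * D * (D * D)).trace := by
    rw [hr]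
    calc _ = (U * (D * D) * (Uᴴ * U) * (D * D) * Uᴴ).trace := by simp only [Matrix.mul_assoc]
      _ = (Uᴴ * (U * (D * D * (D * D)))).trace := by
        rw [hU, trace_mul_comm]; simp only [Matrix.mul_assoc, Matrix.one_mul]
      _ = _ := by rw [← Matrix.mul_assoc, hU, Matrix.one_mul]
  rw [purity, this, hDD, trace_diagonal, Complex.re_sum]
  simp only [Complex.ofReal_re]

end

/-! ### Variances in a Schmidt state -/

theorem mean_schmidtState_local (s : Fin d → ℝ) (X Y : Matrix (Fin d) (Fin d) ℂ) :
    mean (ketBra (schmidtState s)) (X ⊗ₖ (1 : Matrix (Fin d) (Fin d) ℂ) +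
      (1 : Matrix (Fin d) (Fin d) ℂ) ⊗ₖ Y) = ∑ i, s i ^ 2 * ((X i i).re + (Y i i).re) := by
  rw [mean_schmidtState]
  refine Finset.sum_congr rfl fun i _ => ?_
  rw [Finset.sum_eq_single i]
  · simp [sq]
  · intro j _ hj
    simp [one_apply, hj]
  · simp

theorem mean_schmidtState_local_sq (s : Fin d → ℝ) (X Y : Matrix (Fin d) (Fin d) ℂ) :
    mean (ketBra (schmidtState s)) ((X ⊗ₖ (1 : Matrix (Fin d) (Fin d) ℂ) +
      (1 : Matrix (Fin d) (Fin d) ℂ) ⊗ₖ Y) * (X ⊗ₖ (1 : Matrix (Fin d) (Fin d) ℂ) +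
      (1 : Matrix (Fin d) (Fin d) ℂ) ⊗ₖ Y)) =
    ∑ i, s i ^ 2 * (((X * X) i i).re + ((Y * Y) i i).re) +
      2 * ∑ i, ∑ j, s i * s j * (X j i * Y j i).re := by
  have h : (X ⊗ₖ (1 : Matrix (Fin d) (Fin d) ℂ) +
      (1 : Matrix (Fin d) (Fin d) ℂ) ⊗ₖ Y) * (X ⊗ₖ (1 : Matrix (Fin d) (Fin d) ℂ) +
      (1 : Matrix (Fin d) (Fin d) ℂ) ⊗ₖ Y) = ((X * X) ⊗ₖ (1 : Matrix (Fin d) (Fin d) ℂ) +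
      (1 : Matrix (Fin d) (Fin d) ℂ) ⊗ₖ (Y * Y)) + (2 : ℝ) • X ⊗ₖ Y := by
    simp only [add_mul, mul_add, ← mul_kronecker_mul, Matrix.one_mul, Matrix.mul_one, two_smul]
    abel
  rw [h, mean_add, mean_schmidtState_local, mean_smul, mean_schmidtState]
  rfl

theorem re_mul_self_diag {X : Matrix (Fin d) (Fin d) ℂ} (hX : X.IsHermitian) (i : Fin d) :
    ((X * X) i i).re = ∑ j, Complex.normSq (X i j) := by
  rw [mul_apply, Complex.re_sum]
  refine Finset.sum_congr rfl fun j _ => ?_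
  rw [← hX.apply j i, RCLike.star_def, Complex.mul_conj, Complex.ofReal_re]

/-- The right-hand side is `|z + conj w| ^ 2`. -/
theorem two_mul_re_mul_le (z w : ℂ) :
    0 ≤ Complex.normSq z + Complex.normSq w + 2 * (z * w).re := by
  simp only [Complex.normSq_apply, Complex.mul_re]
  nlinarith [sq_nonneg (z.re + w.re), sq_nonneg (z.im - w.im)]

/-- The second moment is a sum over pairs `(i, j)`. Off the diagonal, `N + 2 R ≥ 0` leaves at least
`(s i - s j) ^ 2 * N i j / 2`. The diagonal part is an average of squares with weights `s i ^ 2`,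
and by Jensen it covers the squared mean. Among the remaining nonnegative terms only the pairs
containing `i₀` are kept. -/
theorem sum_le_svar_schmidtState {s : Fin d → ℝ} (hs : ∀ i, 0 ≤ s i) (h1 : ∑ i, s i ^ 2 = 1)
    {X Y : Matrix (Fin d) (Fin d) ℂ} (hX : X.IsHermitian) (hY : Y.IsHermitian) (i₀ : Fin d) :
    ∑ j, (s i₀ - s j) ^ 2 * (Complex.normSq (X i₀ j) + Complex.normSq (Y i₀ j)) ≤
      svar (ketBra (schmidtState s)) (X ⊗ₖ (1 : Matrix (Fin d) (Fin d) ℂ) +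
        (1 : Matrix (Fin d) (Fin d) ℂ) ⊗ₖ Y) := by
  set N : Fin d → Fin d → ℝ := fun i j => Complex.normSq (X i j) + Complex.normSq (Y i j) with hN
  set R : Fin d → Fin d → ℝ := fun i j => (X i j * Y i j).re with hR
  have hN0 : ∀ i j, 0 ≤ N i j := fun i j =>
    add_nonneg (Complex.normSq_nonneg _) (Complex.normSq_nonneg _)
  have hNs : ∀ i j, N j i = N i j := by
    intro i j
    simp only [hN]
    rw [← hX.apply j i, ← hY.apply j i, RCLike.star_def, Complex.normSq_conj,
      Complex.normSq_conj]
  have hRs : ∀ i j, R j i = R i j := by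
    intro i j
    simp only [hR]
    rw [← hX.apply j i, ← hY.apply j i]
    simp
  have hNR : ∀ i j, 0 ≤ N i j + 2 * R i j := fun i j => two_mul_re_mul_le _ _
  have hdiag : ∀ i, N i i + 2 * R i i = ((X i i).re + (Y i i).re) ^ 2 := by
    intro i
    have hx : (X i i).im = 0 := Complex.conj_eq_iff_im.mp (hX.apply i i)
    have hy : (Y i i).im = 0 := Complex.conj_eq_iff_im.mp (hY.apply i i)
    simp only [hN, hR, Complex.normSq_apply, Complex.mul_re, hx, hy]
    ring
  set H : Fin d → Fin d → ℝ := fun i j => 1 / 2 * (s i - s j) ^ 2 * N i j with hH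
  have hH0 : ∀ i j, 0 ≤ H i j := fun i j => by
    have := hN0 i j
    positivity
  have hsq : mean (ketBra (schmidtState s)) ((X ⊗ₖ (1 : Matrix (Fin d) (Fin d) ℂ) +
      (1 : Matrix (Fin d) (Fin d) ℂ) ⊗ₖ Y) * (X ⊗ₖ (1 : Matrix (Fin d) (Fin d) ℂ) +
      (1 : Matrix (Fin d) (Fin d) ℂ) ⊗ₖ Y)) =
      ∑ i, ∑ j, (1 / 2 * (s i ^ 2 + s j ^ 2) * N i j + 2 * (s i * s j) * R i j) := by
    have e1 : ∑ i, ∑ j, s j ^ 2 * N i j = ∑ i, ∑ j, s i ^ 2 * N i j := by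
      rw [Finset.sum_comm]
      exact Finset.sum_congr rfl fun i _ => Finset.sum_congr rfl fun j _ => by rw [hNs]
    have e2 : ∑ i, ∑ j, (1 / 2 * (s i ^ 2 + s j ^ 2) * N i j + 2 * (s i * s j) * R i j) =
        1 / 2 * ∑ i, ∑ j, s i ^ 2 * N i j + 1 / 2 * ∑ i, ∑ j, s j ^ 2 * N i j +
          2 * ∑ i, ∑ j, s i * s j * R j i := by
      simp only [Finset.mul_sum, ← Finset.sum_add_distrib]
      exact Finset.sum_congr rfl fun i _ => Finset.sum_congr rfl fun j _ => by rw [hRs]; ring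
    rw [mean_schmidtState_local_sq, e2, e1]
    simp only [re_mul_self_diag hX, re_mul_self_diag hY, ← Finset.sum_add_distrib, Finset.mul_sum]
    refine Finset.sum_congr rfl fun i _ => Finset.sum_congr rfl fun j _ => ?_
    simp only [hN, hR]
    ring
  have hlow : ∑ i, s i ^ 2 * ((X i i).re + (Y i i).re) ^ 2 + ∑ i, ∑ j, H i j ≤
      ∑ i, ∑ j, (1 / 2 * (s i ^ 2 + s j ^ 2) * N i j + 2 * (s i * s j) * R i j) := by
    have : ∑ i, s i ^ 2 * ((X i i).re + (Y i i).re) ^ 2 =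
        ∑ i, ∑ j, if i = j then s i ^ 2 * ((X i i).re + (Y i i).re) ^ 2 else 0 := by simp
    rw [this, ← Finset.sum_add_distrib]
    refine Finset.sum_le_sum fun i _ => ?_
    rw [← Finset.sum_add_distrib]
    refine Finset.sum_le_sum fun j _ => ?_
    split_ifs with hij
    · subst hij
      simp only [hH, ← hdiag]
      exact le_of_eq (by ring)
    · simp only [hH]
      nlinarith [mul_nonneg (mul_nonneg (hs i) (hs j)) (hNR i j)]
  -- Row and column `i₀` of `H` contribute equally, which cancels the factor `1 / 2`; their common
  -- entry `H i₀ i₀` is zero, so counting it twice is harmless.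
  have hHsum : ∑ j, (s i₀ - s j) ^ 2 * N i₀ j ≤ ∑ i, ∑ j, H i j := by
    have e1 : ∑ j, (s i₀ - s j) ^ 2 * N i₀ j =
        ∑ i, ∑ j, ((if i = i₀ then H i j else 0) + if j = i₀ then H i j else 0) := by
      simp only [Finset.sum_add_distrib]
      rw [Finset.sum_comm]
      simp only [Finset.sum_ite_eq', Finset.mem_univ, if_true, ← Finset.sum_add_distrib]
      refine Finset.sum_congr rfl fun j _ => ?_
      simp only [hH]
      rw [hNs i₀ j]
      ring
    rw [e1]
    refine Finset.sum_le_sum fun i _ => Finset.sum_le_sum fun j _ => ?_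
    by_cases hi : i = i₀ <;> by_cases hj : j = i₀
    · subst hi; subst hj; simp [hH]
    · simp [hi, hj]
    · simp [hi, hj]
    · simpa [hi, hj] using hH0 i j
  have hj := sq_sum_le_sum_mul_sq (fun i => sq_nonneg (s i)) h1 fun i => (X i i).re + (Y i i).re
  rw [svar, hsq, mean_schmidtState_local]
  linarith

/-- The variance in the state given by a column of a unitary. -/
theorem svar_ketBra_column {U : Matrix (Fin d) (Fin d) ℂ} (hU : U * Uᴴ = 1) (i₀ : Fin d)
    {X : Matrix (Fin d) (Fin d) ℂ} (hX : X.IsHermitian) :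
    svar (ketBra (WithLp.toLp 2 fun i => U i i₀)) X =
      ∑ j ∈ Finset.univ.erase i₀, Complex.normSq ((Uᴴ * X * U) i₀ j) := by
  have hk : ketBra (WithLp.toLp 2 fun i => U i i₀) =
      U * ketBra (EuclideanSpace.single i₀ 1) * Uᴴ := by
    refine ketBra_mulVec _ _ _ fun i => ?_
    simp [mulVec, dotProduct]
  have hm : ∀ M : Matrix (Fin d) (Fin d) ℂ, mean (ketBra (EuclideanSpace.single i₀ 1)) M =
      (M i₀ i₀).re := by
    intro M
    have : ketBra (EuclideanSpace.single i₀ (1 : ℂ)) = single i₀ i₀ 1 := by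
      ext i j
      by_cases hi : i = i₀
      · subst hi
        by_cases hj : j = i
        · subst hj; simp [ketBra]
        · simp [ketBra, hj, Ne.symm hj]
      · simp [ketBra, hi, Ne.symm hi]
    simp [mean, this, trace_single_mul]
  have hX' := isHermitian_conjTranspose_mul_mul U hX
  have him : ((Uᴴ * X * U) i₀ i₀).im = 0 := Complex.conj_eq_iff_im.mp (hX'.apply i₀ i₀)
  rw [hk, svar_conj hU, svar, hm, hm, re_mul_self_diag hX',
    ← Finset.add_sum_erase _ _ (Finset.mem_univ i₀), Complex.normSq_apply, him]
  ring

theorem norm_column {U : Matrix (Fin d) (Fin d) ℂ} (hU : U * Uᴴ = 1) (i₀ : Fin d) :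
    ‖(WithLp.toLp 2 fun i => U i i₀ : EuclideanSpace ℂ (Fin d))‖ = 1 := by
  have h := congrFun (congrFun (mul_eq_one_comm.mp hU : Uᴴ * U = 1) i₀) i₀
  rw [mul_apply, one_apply_eq] at h
  have h2 := congrArg Complex.re h
  rw [Complex.re_sum] at h2
  rw [EuclideanSpace.norm_eq, Real.sqrt_eq_one, ← Complex.one_re, ← h2]
  refine Finset.sum_congr rfl fun i _ => ?_
  rw [conjTranspose_apply, RCLike.star_def, mul_comm, Complex.mul_conj, Complex.ofReal_re,
    Complex.normSq_eq_norm_sq]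

end Schmidt

/-! ### Lower bounds on `V` -/

section LowerBound

/-- The set whose supremum is `V`. -/
noncomputable def feasibleSet {a b : ℕ} (A : Fin (a ^ 2) → Matrix (Fin a) (Fin a) ℂ)
    (B : Fin (b ^ 2) → Matrix (Fin b) (Fin b) ℂ)
    (ρ : Matrix (Fin a × Fin b) (Fin a × Fin b) ℂ) : Set ℝ :=
  {t : ℝ | t ≤ 1 ∧ ∃ κA κB, IsKappaPair A B κA κB ∧
    (covMatrix ρ (jointObs A B) - t • fromBlocks κA 0 0 κB).PosSemidef}

theorem le_V_of_mem {a b : ℕ} {A : Fin (a ^ 2) → Matrix (Fin a) (Fin a) ℂ}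
    {B : Fin (b ^ 2) → Matrix (Fin b) (Fin b) ℂ}
    {ρ : Matrix (Fin a × Fin b) (Fin a × Fin b) ℂ} {t : ℝ} (ht : t ∈ feasibleSet A B ρ) :
    t ≤ V A B ρ :=
  le_csSup ⟨1, fun _ hx => hx.1⟩ ht

/-- A real test vector encodes a pair of Hermitian local observables, so positivity reduces to the
variance inequality. -/
theorem mem_feasibleSet {a b K : ℕ} (A : Fin (a ^ 2) → Matrix (Fin a) (Fin a) ℂ)
    (B : Fin (b ^ 2) → Matrix (Fin b) (Fin b) ℂ) (hA : ∀ i, (A i).IsHermitian)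
    (hB : ∀ i, (B i).IsHermitian) (ρ : Matrix (Fin a × Fin b) (Fin a × Fin b) ℂ)
    {t : ℝ} (ht : t ≤ 1) (p : Fin K → ℝ) (ψ : Fin K → EuclideanSpace ℂ (Fin a))
    (φ : Fin K → EuclideanSpace ℂ (Fin b)) (hp : ∀ k, 0 ≤ p k) (hp1 : ∑ k, p k = 1)
    (hψ : ∀ k, ‖ψ k‖ = 1) (hφ : ∀ k, ‖φ k‖ = 1)
    (h : ∀ X Y, X.IsHermitian → Y.IsHermitian →
      t * ∑ k, p k * (svar (ketBra (ψ k)) X + svar (ketBra (φ k)) Y) ≤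
        svar ρ (X ⊗ₖ (1 : Matrix (Fin b) (Fin b) ℂ) + (1 : Matrix (Fin a) (Fin a) ℂ) ⊗ₖ Y)) :
    t ∈ feasibleSet A B ρ := by
  have hs : ∀ {m n : ℕ} (M : Fin (n ^ 2) → Matrix (Fin m) (Fin m) ℂ)
      (χ : Fin K → EuclideanSpace ℂ (Fin m)),
      (∑ k, p k • covMatrix (ketBra (χ k)) M).IsHermitian := by
    intro m n M χ
    rw [Matrix.IsHermitian, conjTranspose_sum]
    refine Finset.sum_congr rfl fun k _ => ?_
    rw [conjTranspose_smul, (covMatrix_isHermitian _ _).eq, star_trivial]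
  have hherm : ∀ {m : ℕ} (M : Fin (m ^ 2) → Matrix (Fin m) (Fin m) ℂ) (_ : ∀ i, (M i).IsHermitian)
      (v : Fin (m ^ 2) → ℝ), (∑ i, v i • M i).IsHermitian := by
    intro m M hM v
    rw [Matrix.IsHermitian, conjTranspose_sum]
    refine Finset.sum_congr rfl fun k _ => ?_
    rw [conjTranspose_smul, (hM k).eq, star_trivial]
  refine
    ⟨ht, _, _, ⟨K, p, ψ, φ, hp, hp1, hψ, hφ, rfl, rfl⟩, ?_⟩
  refine PosSemidef.of_dotProduct_mulVec_nonneg ?_ fun v => ?_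
  · refine (covMatrix_isHermitian _ _).sub ?_
    rw [Matrix.IsHermitian, conjTranspose_smul, star_trivial, fromBlocks_conjTranspose,
      (hs A ψ).eq, (hs B φ).eq, conjTranspose_zero, conjTranspose_zero]
  · rw [star_trivial, quadratic_form_sub]
    exact sub_nonneg.mpr (h _ _ (hherm A hA _) (hherm B hB _))

/-- Members of the set defining `V` satisfy the variance inequality for all local observables. -/
theorem variance_bound_of_posSemidef {a b : ℕ} {A : Fin (a ^ 2) → Matrix (Fin a) (Fin a) ℂ}
    {B : Fin (b ^ 2) → Matrix (Fin b) (Fin b) ℂ} (hA : IsLOO A) (hB : IsLOO B)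
    {ρ : Matrix (Fin a × Fin b) (Fin a × Fin b) ℂ} {K : ℕ} {t : ℝ} {p : Fin K → ℝ}
    {ψ : Fin K → EuclideanSpace ℂ (Fin a)} {φ : Fin K → EuclideanSpace ℂ (Fin b)}
    (h : (covMatrix ρ (jointObs A B) - t • fromBlocks (∑ k, p k • covMatrix (ketBra (ψ k)) A) 0 0
      (∑ k, p k • covMatrix (ketBra (φ k)) B)).PosSemidef)
    {X : Matrix (Fin a) (Fin a) ℂ} {Y : Matrix (Fin b) (Fin b) ℂ}
    (hX : X.IsHermitian) (hY : Y.IsHermitian) :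
    t * ∑ k, p k * (svar (ketBra (ψ k)) X + svar (ketBra (φ k)) Y) ≤
      svar ρ (X ⊗ₖ (1 : Matrix (Fin b) (Fin b) ℂ) + (1 : Matrix (Fin a) (Fin a) ℂ) ⊗ₖ Y) := by
  have h1 := h.dotProduct_mulVec_nonneg
    (Sum.elim (fun i => (A i * X).trace.re) fun i => (B i * Y).trace.re)
  rw [star_trivial, quadratic_form_sub] at h1
  simp only [Sum.elim_inl, Sum.elim_inr, ← hA.real_expansion hX, ← hB.real_expansion hY] at h1
  linarith

/-- With `a = s i₀` and `b = s j₀`, normalisation gives `1 - (a - b) ^ 2 = 2ab + ∑ s k ^ 2` over the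
other `k`. As `s k ≤ a`, this is at most `a ∑ c k * s k`. Cauchy–Schwarz with `∑ c k ^ 2 = 4 + (d -
2)` bounds its square by `(d + 2) a² (1 - a²)`, and `2 a² (1 - a²) = 1 - a⁴ - R² ≤ 1 - ∑ s i ^ 4`.
-/
theorem one_sub_sq_le {d : ℕ} {s : Fin d → ℝ} (hs : ∀ i, 0 ≤ s i) (h1 : ∑ i, s i ^ 2 = 1)
    {i₀ j₀ : Fin d} (hij : j₀ ≠ i₀) (hmax : ∀ j, s j ≤ s i₀) :
    (s i₀ - s j₀) ^ 2 ≤ 1 ∧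
      (1 - (s i₀ - s j₀) ^ 2) ^ 2 ≤ ((d : ℝ) + 2) / 2 * (1 - ∑ i, s i ^ 4) := by
  have hj₀ : j₀ ∈ Finset.univ.erase i₀ := by simp [hij]
  set c : Fin d → ℝ := fun k => if k = j₀ then 2 else 1
  set R : ℝ := ∑ k ∈ Finset.univ.erase i₀, s k ^ 2 with hR
  have hRa : s i₀ ^ 2 + R = 1 := by
    rw [hR, ← h1]
    exact Finset.add_sum_erase _ (fun k => s k ^ 2) (Finset.mem_univ i₀)
  have hR2 : R = s j₀ ^ 2 + ∑ k ∈ (Finset.univ.erase i₀).erase j₀, s k ^ 2 :=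
    (Finset.add_sum_erase _ _ hj₀).symm
  have hQ : 0 ≤ ∑ k ∈ (Finset.univ.erase i₀).erase j₀, s k ^ 2 :=
    Finset.sum_nonneg fun k _ => sq_nonneg _
  have hab := mul_nonneg (hs i₀) (hs j₀)
  have hle : (s i₀ - s j₀) ^ 2 ≤ 1 := by nlinarith
  refine ⟨hle, ?_⟩
  have hcs : ∑ k ∈ Finset.univ.erase i₀, c k * s k =
      2 * s j₀ + ∑ k ∈ (Finset.univ.erase i₀).erase j₀, s k := by
    rw [← Finset.add_sum_erase _ _ hj₀]
    congr 1
    · simp [c]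
    · refine Finset.sum_congr rfl fun k hk => ?_
      simp [c, Finset.ne_of_mem_erase hk]
  have hcc : ∑ k ∈ Finset.univ.erase i₀, c k ^ 2 = (d : ℝ) + 2 := by
    rw [← Finset.add_sum_erase _ _ hj₀]
    have : ∑ k ∈ (Finset.univ.erase i₀).erase j₀, c k ^ 2 = (d : ℝ) - 2 := by
      rw [Finset.sum_congr rfl (g := fun _ => (1 : ℝ))
        fun k hk => by simp [c, Finset.ne_of_mem_erase hk]]
      rw [Finset.sum_const, Finset.card_erase_of_mem hj₀,
        Finset.card_erase_of_mem (Finset.mem_univ _), Finset.card_univ, Fintype.card_fin,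
        Nat.sub_sub, nsmul_eq_mul, mul_one, Nat.cast_sub]
      · norm_num
      · have := Fintype.one_lt_card_iff.mpr ⟨_, _, hij⟩
        rw [Fintype.card_fin] at this
        omega
    rw [this]
    simp only [c, if_true]
    ring
  have hlin : 1 - (s i₀ - s j₀) ^ 2 ≤ s i₀ * ∑ k ∈ Finset.univ.erase i₀, c k * s k := by
    have : ∑ k ∈ (Finset.univ.erase i₀).erase j₀, s k ^ 2 ≤
        s i₀ * ∑ k ∈ (Finset.univ.erase i₀).erase j₀, s k := by
      rw [Finset.mul_sum]
      exact Finset.sum_le_sum fun k _ => by nlinarith [hs k, hmax k]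
    rw [hcs]
    nlinarith
  have hCS := Finset.sum_mul_sq_le_sq_mul_sq (Finset.univ.erase i₀) c s
  rw [hcc] at hCS
  have h4 : ∑ i, s i ^ 4 ≤ s i₀ ^ 4 + R ^ 2 := by
    rw [← Finset.add_sum_erase _ _ (Finset.mem_univ i₀)]
    have := Finset.sum_sq_le_sq_sum_of_nonneg (s := Finset.univ.erase i₀) (f := fun k => s k ^ 2)
      fun k _ => sq_nonneg _
    have e : ∀ k, (s k ^ 2) ^ 2 = s k ^ 4 := fun k => by ring
    simp only [e] at this
    linarith
  have hsq := pow_le_pow_left₀ (sub_nonneg.mpr hle) hlin 2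
  have hd : (0 : ℝ) ≤ d := Nat.cast_nonneg d
  calc _ ≤ s i₀ ^ 2 * (∑ k ∈ Finset.univ.erase i₀, c k * s k) ^ 2 := by rw [← mul_pow]; exact hsq
    _ ≤ s i₀ ^ 2 * (((d : ℝ) + 2) * R) := by gcongr
    _ = ((d : ℝ) + 2) / 2 * (1 - (s i₀ ^ 4 + R ^ 2)) := by
      have : R = 1 - s i₀ ^ 2 := by linarith
      rw [this]
      ring
    _ ≤ _ := by gcongr

/-- The witnesses are the Schmidt vectors of the largest coefficient. Every other coefficient is at
most the second largest, so each weight `(s i₀ - s j) ^ 2` with `j ≠ i₀` dominates `t`. -/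
theorem exists_product_variance_bound {d : ℕ} (hd : 2 ≤ d) {ψ : Bipartite d d} (hψ : ‖ψ‖ = 1) :
    ∃ (t : ℝ) (e f : EuclideanSpace ℂ (Fin d)), 0 ≤ t ∧ t ≤ 1 ∧ ‖e‖ = 1 ∧ ‖f‖ = 1 ∧
      1 - t ≤ √(((d : ℝ) + 2) / 2 * (1 - purity (reducedA (ketBra ψ)))) ∧
      ∀ X Y, X.IsHermitian → Y.IsHermitian → t * (svar (ketBra e) X + svar (ketBra f) Y) ≤
        svar (ketBra ψ) (X ⊗ₖ (1 : Matrix (Fin d) (Fin d) ℂ) +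
          (1 : Matrix (Fin d) (Fin d) ℂ) ⊗ₖ Y) := by
  obtain ⟨s, U, W, h⟩ := exists_isSchmidt ψ
  have hs1 := h.sum_sq hψ
  obtain ⟨i₀, -, hmax⟩ := Finset.exists_max_image Finset.univ s ⟨⟨0, by omega⟩, by simp⟩
  have hne : (Finset.univ.erase i₀).Nonempty := by
    rw [← Finset.card_pos, Finset.card_erase_of_mem (Finset.mem_univ _), Finset.card_univ,
      Fintype.card_fin]
    omega
  obtain ⟨j₀, hj₀, hmax'⟩ := Finset.exists_max_image (Finset.univ.erase i₀) s hne
  obtain ⟨ht, hb⟩ := one_sub_sq_le h.nonneg hs1 (Finset.ne_of_mem_erase hj₀)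
    fun j => hmax j (Finset.mem_univ j)
  refine ⟨(s i₀ - s j₀) ^ 2, _, _, sq_nonneg _, ht, norm_column h.left i₀, norm_column h.right i₀,
    ?_, fun X Y hX hY => ?_⟩
  · rw [h.purity_eq]
    exact Real.le_sqrt_of_sq_le hb
  · rw [svar_ketBra_column h.left i₀ hX, svar_ketBra_column h.right i₀ hY, h.svar_eq]
    refine le_trans ?_ (sum_le_svar_schmidtState h.nonneg hs1
      (isHermitian_conjTranspose_mul_mul U hX) (isHermitian_conjTranspose_mul_mul W hY) i₀)
    rw [← Finset.add_sum_erase _ _ (Finset.mem_univ i₀), ← Finset.sum_add_distrib, Finset.mul_sum,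
      sub_self, zero_pow two_ne_zero, zero_mul, zero_add]
    refine Finset.sum_le_sum fun j hj => ?_
    refine mul_le_mul_of_nonneg_right ?_
      (add_nonneg (Complex.normSq_nonneg _) (Complex.normSq_nonneg _))
    have h1 := hmax' j hj
    have h2 := hmax j₀ (Finset.mem_univ _)
    exact pow_le_pow_left₀ (by linarith) (by linarith) 2

/-- The pure-state values average to `T = ∑ p i * t i`. Giving the product states weights `p i * t i
/ T` turns the averaged inequalities into one with common factor `T`. -/
theorem exists_mem_feasibleSet {d : ℕ} (hd : 2 ≤ d)
    {A B : Fin (d ^ 2) → Matrix (Fin d) (Fin d) ℂ} (hA : IsLOO A) (hB : IsLOO B)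
    {N : ℕ} {p : Fin N → ℝ} {ψ : Fin N → Bipartite d d} (hp : ∀ i, 0 ≤ p i) (hp1 : ∑ i, p i = 1)
    (hψ : ∀ i, ‖ψ i‖ = 1) :
    ∃ T ∈ feasibleSet A B (∑ i, (p i : ℂ) • ketBra (ψ i)), 1 - T ≤
      ∑ i, p i * √(((d : ℝ) + 2) / 2 * (1 - purity (reducedA (ketBra (ψ i))))) := by
  choose t e f ht0 ht1 he hf hb hv using fun i => exists_product_variance_bound hd (hψ i)
  have hT0 : 0 ≤ ∑ i, p i * t i := Finset.sum_nonneg fun i _ => mul_nonneg (hp i) (ht0 i)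
  have hT1 : ∑ i, p i * t i ≤ 1 := by
    rw [← hp1]
    exact Finset.sum_le_sum fun i _ => mul_le_of_le_one_right (hp i) (ht1 i)
  have key : ∀ X Y, X.IsHermitian → Y.IsHermitian →
      ∑ i, p i * (t i * (svar (ketBra (e i)) X + svar (ketBra (f i)) Y)) ≤
      svar (∑ i, (p i : ℂ) • ketBra (ψ i)) (X ⊗ₖ (1 : Matrix (Fin d) (Fin d) ℂ) +
          (1 : Matrix (Fin d) (Fin d) ℂ) ⊗ₖ Y) := fun X Y hX hY =>
    (Finset.sum_le_sum fun i _ => mul_le_mul_of_nonneg_left (hv i X Y hX hY) (hp i)).trans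
      (sum_svar_le hp hp1 _ _)
  refine ⟨∑ i, p i * t i, ?_, ?_⟩
  -- If `T = 0`, the reweighting is undefined, but every `p i * t i` vanishes and the original
  -- weights serve.
  · rcases hT0.eq_or_lt with hT | hT
    · have hz : ∀ i, p i * t i = 0 := fun i =>
        (Finset.sum_eq_zero_iff_of_nonneg fun i _ => mul_nonneg (hp i) (ht0 i)).mp hT.symm i
          (Finset.mem_univ i)
      refine mem_feasibleSet A B hA.1 hB.1 _ hT1 p e f hp hp1 he hf fun X Y hX hY => ?_
      refine le_trans (le_of_eq ?_) (key X Y hX hY)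
      rw [← hT, zero_mul]
      exact (Finset.sum_eq_zero fun i _ => by rw [← mul_assoc, hz, zero_mul]).symm
    · refine mem_feasibleSet A B hA.1 hB.1 _ hT1 (fun i => p i * t i / ∑ i, p i * t i) e f
        (fun i => div_nonneg (mul_nonneg (hp i) (ht0 i)) hT0) ?_ he hf fun X Y hX hY => ?_
      · rw [← Finset.sum_div, div_self hT.ne']
      · refine le_trans (le_of_eq ?_) (key X Y hX hY)
        rw [Finset.mul_sum]
        refine Finset.sum_congr rfl fun i _ => ?_
        field_simp
  · have h1 : 1 - ∑ i, p i * t i = ∑ i, p i * (1 - t i) := by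
      simp only [mul_sub, mul_one, Finset.sum_sub_distrib, hp1]
    rw [h1]
    exact Finset.sum_le_sum fun i _ => mul_le_mul_of_nonneg_left (hb i) (hp i)

/-- A convex combination of pure states has entanglement parameter at most a multiple of the
average concurrence. -/
theorem entParam_decomposition_le {d : ℕ} (hd : 2 ≤ d)
    {A B : Fin (d ^ 2) → Matrix (Fin d) (Fin d) ℂ} (hA : IsLOO A) (hB : IsLOO B) {c : ℝ}
    (hc : ((d : ℝ) + 2) / 2 ≤ c ^ 2 * ((d : ℝ) / ((d : ℝ) - 1))) (hc0 : 0 ≤ c)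
    {N : ℕ} {p : Fin N → ℝ} {ψ : Fin N → Bipartite d d} (hp : ∀ i, 0 ≤ p i) (hp1 : ∑ i, p i = 1)
    (hψ : ∀ i, ‖ψ i‖ = 1) :
    entParam A B (∑ i, (p i : ℂ) • ketBra (ψ i)) ≤ c * ∑ i, p i * pureConcurrence (ψ i) := by
  obtain ⟨T, hT, hb⟩ := exists_mem_feasibleSet hd hA hB hp hp1 hψ
  refine (sub_le_sub_left (le_V_of_mem hT) 1).trans (hb.trans ?_)
  rw [Finset.mul_sum]
  refine Finset.sum_le_sum fun i _ => ?_
  rw [mul_left_comm]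
  refine mul_le_mul_of_nonneg_left ?_ (hp i)
  have hd0 : (0 : ℝ) ≤ ((d : ℝ) + 2) / 2 := by positivity
  rw [Real.sqrt_mul hd0, pureConcurrence, ← mul_assoc]
  refine mul_le_mul_of_nonneg_right ?_ (Real.sqrt_nonneg _)
  refine (Real.sqrt_le_sqrt hc).trans (le_of_eq ?_)
  rw [Real.sqrt_mul (sq_nonneg c), Real.sqrt_sq hc0]

theorem entParam_ketBra_le {d : ℕ} (hd : 2 ≤ d)
    {A B : Fin (d ^ 2) → Matrix (Fin d) (Fin d) ℂ} (hA : IsLOO A) (hB : IsLOO B) {c : ℝ}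
    (hc : ((d : ℝ) + 2) / 2 ≤ c ^ 2 * ((d : ℝ) / ((d : ℝ) - 1))) (hc0 : 0 ≤ c)
    {ψ : Bipartite d d} (hψ : ‖ψ‖ = 1) : entParam A B (ketBra ψ) ≤ c * pureConcurrence ψ := by
  simpa using entParam_decomposition_le hd hA hB hc hc0 (N := 1) (p := fun _ => 1)
    (ψ := fun _ => ψ) (by simp) (by simp) (fun _ => hψ)

/-- Every state is a convex combination of pure states. -/
theorem IsState.exists_decomposition {n : Type*} [Fintype n] {ρ : Matrix n n ℂ}
    (hρ : IsState ρ) : ∃ (N : ℕ) (p : Fin N → ℝ) (ψ : Fin N → EuclideanSpace ℂ n),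
      (∀ i, 0 ≤ p i) ∧ ∑ i, p i = 1 ∧ (∀ i, ‖ψ i‖ = 1) ∧ ρ = ∑ i, (p i : ℂ) • ketBra (ψ i) := by
  classical
  have hH := hρ.1.1
  have hsum : ρ = ∑ i, (hH.eigenvalues i : ℂ) • ketBra (hH.eigenvectorBasis i) := by
    conv_lhs => rw [hH.spectral_theorem]
    ext a b
    rw [Unitary.conjStarAlgAut_apply]
    simp only [mul_apply, diagonal_apply, Matrix.sum_apply, Matrix.smul_apply, ketBra, of_apply,
      mul_ite, mul_zero, Finset.sum_ite_eq', Finset.mem_univ, if_true, smul_eq_mul,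
      star_apply, hH.eigenvectorUnitary_apply, Function.comp_apply]
    refine Finset.sum_congr rfl fun i _ => ?_
    simp only [RCLike.ofReal_eq_complex_ofReal]
    ring
  have e := (Fintype.equivFin n).symm
  refine ⟨Fintype.card n, fun i => hH.eigenvalues (e i), fun i => hH.eigenvectorBasis (e i),
    fun i => hρ.1.eigenvalues_nonneg _, ?_, fun i => hH.eigenvectorBasis.orthonormal.1 _, ?_⟩
  · rw [e.sum_comp]
    have := hρ.2
    rw [hH.trace_eq_sum_eigenvalues] at this
    simpa only [RCLike.ofReal_eq_complex_ofReal, ← Complex.ofReal_sum, Complex.ofReal_eq_one]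
      using this
  · rw [e.sum_comp fun i => (hH.eigenvalues i : ℂ) • ketBra (hH.eigenvectorBasis i)]
    exact hsum

/-- Upper bounds on `V` through `csSup_le` need this, since the real supremum of the empty set is
the default value `0`. -/
theorem feasibleSet_nonempty {d : ℕ} (hd : 2 ≤ d)
    {A B : Fin (d ^ 2) → Matrix (Fin d) (Fin d) ℂ} (hA : IsLOO A) (hB : IsLOO B)
    {ρ : Matrix (Fin d × Fin d) (Fin d × Fin d) ℂ} (hρ : IsState ρ) :
    (feasibleSet A B ρ).Nonempty := by
  obtain ⟨N, p, ψ, hp, hp1, hψ, rfl⟩ := hρ.exists_decomposition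
  obtain ⟨T, hT, -⟩ := exists_mem_feasibleSet hd hA hB hp hp1 hψ
  exact ⟨T, hT⟩

theorem entParam_le_concurrence {d : ℕ} (hd : 2 ≤ d)
    {A B : Fin (d ^ 2) → Matrix (Fin d) (Fin d) ℂ} (hA : IsLOO A) (hB : IsLOO B) {c : ℝ}
    (hc : ((d : ℝ) + 2) / 2 ≤ c ^ 2 * ((d : ℝ) / ((d : ℝ) - 1))) (hc0 : 0 < c)
    {ρ : Matrix (Fin d × Fin d) (Fin d × Fin d) ℂ} (hρ : IsState ρ) :
    entParam A B ρ / c ≤ concurrence ρ := by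
  obtain ⟨N, p, ψ, hp, hp1, hψ, h⟩ := hρ.exists_decomposition
  refine le_csInf ⟨_, N, p, ψ, hp, hp1, hψ, h, rfl⟩ ?_
  rintro x ⟨N, p, ψ, hp, hp1, hψ, rfl, rfl⟩
  rw [div_le_iff₀' hc0]
  exact entParam_decomposition_le hd hA hB hc hc0.le hp hp1 hψ

end LowerBound

/-! ### Upper bounds on `V` -/

section UpperBound

theorem sum_dotProduct_mulVec_basis {n : ℕ}
    (u : OrthonormalBasis (Fin n) ℝ (EuclideanSpace ℝ (Fin n))) (P : Matrix (Fin n) (Fin n) ℝ) :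
    ∑ i, (u i : Fin n → ℝ) ⬝ᵥ (P *ᵥ (u i : Fin n → ℝ)) = P.trace := by
  set O : Matrix (Fin n) (Fin n) ℝ := of fun a i => u i a with hO
  have h1 : O * Oᴴ = 1 := mul_eq_one_comm.mp (basis_matrix_unitary u)
  have h2 : (Oᴴ * (P * O)).trace = P.trace := by
    rw [trace_mul_comm, Matrix.mul_assoc, h1, Matrix.mul_one]
  rw [← h2]
  simp only [trace, diag_apply]
  refine Finset.sum_congr rfl fun i _ => ?_
  simp only [mul_apply, dotProduct, mulVec, hO, conjTranspose_apply, of_apply, star_trivial]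

/-- The trace norm of the off-diagonal block of a positive semidefinite block matrix. -/
theorem traceNorm_sq_le {n : ℕ} {P C Q : Matrix (Fin n) (Fin n) ℝ}
    (h : (fromBlocks P C Cᵀ Q).PosSemidef) : traceNorm C ^ 2 ≤ P.trace * Q.trace := by
  obtain ⟨v, u, hvu⟩ := exists_singularValue_bases (𝕜 := ℝ) (n := n) (by simp) (by simp)
    (toEuclideanLin C)
  set σ : Fin n → ℝ := fun i => (toEuclideanLin C).singularValues i
  have hC : ∀ i, C *ᵥ (v i : Fin n → ℝ) = σ i • (u i : Fin n → ℝ) := by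
    intro i
    have := congrArg WithLp.ofLp (hvu i)
    simpa [toLpLin_apply] using this
  have huu : ∀ i, (u i : Fin n → ℝ) ⬝ᵥ (u i : Fin n → ℝ) = 1 := by
    intro i
    have := orthonormal_iff_ite.mp u.orthonormal i i
    rw [if_pos rfl, PiLp.inner_apply] at this
    rw [← this]
    rfl
  -- Testing positivity on `(x • u i, -v i)` and summing over `i` gives a quadratic in `x` that is
  -- never negative; its discriminant yields the claim.
  have hq : ∀ x : ℝ, 0 ≤ P.trace * (x * x) + (-2 * traceNorm C) * x + Q.trace := by
    intro x
    have hi : ∀ i, 0 ≤ x * x * ((u i : Fin n → ℝ) ⬝ᵥ (P *ᵥ (u i : Fin n → ℝ))) - 2 * x * σ i +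
        (v i : Fin n → ℝ) ⬝ᵥ (Q *ᵥ (v i : Fin n → ℝ)) := by
      intro i
      have h1 := h.dotProduct_mulVec_nonneg
        (Sum.elim (x • (u i : Fin n → ℝ)) (-(v i : Fin n → ℝ)))
      have h2 : (v i : Fin n → ℝ) ⬝ᵥ (Cᵀ *ᵥ (u i : Fin n → ℝ)) = σ i := by
        rw [dotProduct_mulVec, vecMul_transpose, hC, smul_dotProduct, huu, smul_eq_mul, mul_one]
      rw [star_trivial, fromBlocks_mulVec] at h1
      simp only [Sum.elim_comp_inl, Sum.elim_comp_inr, sumElim_dotProduct_sumElim, mulVec_neg,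
        mulVec_smul, hC, dotProduct_add, dotProduct_neg, neg_dotProduct, smul_dotProduct,
        dotProduct_smul, huu, h2, smul_eq_mul] at h1
      linarith
    have := Finset.sum_nonneg fun i (_ : i ∈ Finset.univ) => hi i
    rw [Finset.sum_add_distrib, Finset.sum_sub_distrib, ← Finset.mul_sum, ← Finset.mul_sum,
      sum_dotProduct_mulVec_basis, sum_dotProduct_mulVec_basis] at this
    have e : traceNorm C = ∑ i, σ i := rfl
    rw [e]
    linarith
  have := discrim_le_zero hq
  rw [discrim] at this
  linarith

theorem trace_sum_covMatrix {d K : ℕ} {A : Fin (d ^ 2) → Matrix (Fin d) (Fin d) ℂ} (hA : IsLOO A)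
    {p : Fin K → ℝ} (hp1 : ∑ k, p k = 1) {ψ : Fin K → EuclideanSpace ℂ (Fin d)}
    (hψ : ∀ k, ‖ψ k‖ = 1) : (∑ k, p k • covMatrix (ketBra (ψ k)) A).trace = d - 1 := by
  rw [trace_sum]
  simp only [trace_smul, hA.trace_covMatrix (ketBra_isHermitian _) (trace_ketBra (hψ _)),
    purity_ketBra (hψ _), smul_eq_mul, ← Finset.sum_mul, hp1, one_mul]

theorem IsState.reducedA {a b : ℕ} {ρ : Matrix (Fin a × Fin b) (Fin a × Fin b) ℂ}
    (hρ : IsState ρ) : (reducedA ρ).IsHermitian ∧ (reducedA ρ).trace = 1 := by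
  constructor
  · ext i j
    simp only [conjTranspose_apply, CovEnt.reducedA, of_apply, star_sum, hρ.1.1.apply]
  · rw [← hρ.2]
    simp only [trace, diag_apply, CovEnt.reducedA, of_apply, Fintype.sum_prod_type]

theorem IsState.reducedB {a b : ℕ} {ρ : Matrix (Fin a × Fin b) (Fin a × Fin b) ℂ}
    (hρ : IsState ρ) : (reducedB ρ).IsHermitian ∧ (reducedB ρ).trace = 1 := by
  constructor
  · ext i j
    simp only [conjTranspose_apply, CovEnt.reducedB, of_apply, star_sum, hρ.1.1.apply]
  · rw [← hρ.2]
    simp only [trace, diag_apply, CovEnt.reducedB, of_apply, Fintype.sum_prod_type]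
    exact Finset.sum_comm

/-- The entanglement parameter is bounded below by the trace norm of the correlation block. -/
theorem le_entParam {d : ℕ} (hd : 2 ≤ d) {A B : Fin (d ^ 2) → Matrix (Fin d) (Fin d) ℂ}
    (hA : IsLOO A) (hB : IsLOO B)
    {ρ : Matrix (Fin d × Fin d) (Fin d × Fin d) ℂ} (hρ : IsState ρ) :
    (purity (reducedA ρ) + purity (reducedB ρ) - 2) / 2 +
      √(1 / 4 * (purity (reducedA ρ) - purity (reducedB ρ)) ^ 2 +
        traceNorm (corrBlock A B ρ) ^ 2) ≤ ((d : ℝ) - 1) * entParam A B ρ := by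
  have hd1 : (0 : ℝ) < (d : ℝ) - 1 := by
    have : (2 : ℝ) ≤ d := by exact_mod_cast hd
    linarith
  set pA := purity (reducedA ρ)
  set pB := purity (reducedB ρ)
  set r := √(1 / 4 * (pA - pB) ^ 2 + traceNorm (corrBlock A B ρ) ^ 2)
  rw [← div_le_iff₀' hd1, entParam, le_sub_comm]
  refine csSup_le (feasibleSet_nonempty hd hA hB hρ) ?_
  rintro t ⟨-, _, _, ⟨K, p, ψ, φ, hp, hp1, hψ, hφ, rfl, rfl⟩, h⟩
  rw [le_sub_comm, div_le_iff₀' hd1]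
  rw [covMatrix_jointObs, fromBlocks_smul, smul_zero, sub_eq_add_neg, fromBlocks_neg,
    fromBlocks_add, neg_zero, add_zero, add_zero] at h
  have htr := traceNorm_sq_le h
  simp only [← sub_eq_add_neg, trace_sub, trace_smul, trace_sum_covMatrix hA hp1 hψ,
    trace_sum_covMatrix hB hp1 hφ, hA.trace_covMatrix hρ.reducedA.1 hρ.reducedA.2,
    hB.trace_covMatrix hρ.reducedB.1 hρ.reducedB.2, smul_eq_mul] at htr
  have hPA : 0 ≤ (d : ℝ) - pA - t * (d - 1) := by
    have := Finset.sum_nonneg fun i (_ : i ∈ Finset.univ) => h.diag_nonneg (i := .inl i)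
    simp only [fromBlocks_apply₁₁] at this
    change 0 ≤ Matrix.trace _ at this
    simpa only [← sub_eq_add_neg, trace_sub, trace_smul, trace_sum_covMatrix hA hp1 hψ,
      hA.trace_covMatrix hρ.reducedA.1 hρ.reducedA.2, smul_eq_mul] using this
  have hPB : 0 ≤ (d : ℝ) - pB - t * (d - 1) := by
    have := Finset.sum_nonneg fun i (_ : i ∈ Finset.univ) => h.diag_nonneg (i := .inr i)
    simp only [fromBlocks_apply₂₂] at this
    change 0 ≤ Matrix.trace _ at this
    simpa only [← sub_eq_add_neg, trace_sub, trace_smul, trace_sum_covMatrix hB hp1 hφ,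
      hB.trace_covMatrix hρ.reducedB.1 hρ.reducedB.2, smul_eq_mul] using this
  -- For the block traces `α` and `β`, `((α + β) / 2) ^ 2 = α β + (α - β) ^ 2 / 4`, where `α - β` is
  -- the difference of purities up to sign. Nonnegativity of the traces permits taking the root.
  have hr : r ≤ ((d : ℝ) - pA - t * (d - 1) + (d - pB - t * (d - 1))) / 2 := by
    refine Real.sqrt_le_iff.mpr ⟨by linarith, ?_⟩
    nlinarith
  linarith

theorem sum_svar_ketBra {d : ℕ} {A : Fin (d ^ 2) → Matrix (Fin d) (Fin d) ℂ} (hA : IsLOO A)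
    {ψ : EuclideanSpace ℂ (Fin d)} (hψ : ‖ψ‖ = 1) : ∑ i, svar (ketBra ψ) (A i) = d - 1 := by
  rw [hA.sum_svar (ketBra_isHermitian _) (trace_ketBra hψ), purity_ketBra hψ]

/-- Each `A α` is paired with minus its transpose relative to the Schmidt bases. Both families are
complete and orthonormal, so the local variances total `2 (d - 1)`, while the joint second moments
total `2 d - 2 (∑ s) ^ 2` by completeness. -/
theorem le_of_posSemidef_schmidt {d : ℕ} {A B : Fin (d ^ 2) → Matrix (Fin d) (Fin d) ℂ}
    (hA : IsLOO A) (hB : IsLOO B) {ψ : Bipartite d d} (hψ : ‖ψ‖ = 1) {s : Fin d → ℝ}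
    {U W : Matrix (Fin d) (Fin d) ℂ} (hs : IsSchmidt ψ s U W) {t : ℝ}
    {κA κB : Matrix (Fin (d ^ 2)) (Fin (d ^ 2)) ℝ} (hκ : IsKappaPair A B κA κB)
    (h : (covMatrix (ketBra ψ) (jointObs A B) - t • fromBlocks κA 0 0 κB).PosSemidef) :
    t * (d - 1) ≤ d - (∑ i, s i) ^ 2 := by
  obtain ⟨K, p, χ, φ, hp, hp1, hχ, hφ, rfl, rfl⟩ := hκ
  have hτ : IsLOO fun α => Uᴴ * A α * U := hA.conj hs.left
  have hτ' := hτ.neg_transpose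
  have hWW : Wᴴ * W = 1 := mul_eq_one_comm.mp hs.right
  -- Conjugating by `Wᴴ` anticipates the change to the Schmidt basis, where this observable becomes
  -- exactly the negative transpose.
  have hY : IsLOO fun α => Wᴴᴴ * (-(Uᴴ * A α * U)ᵀ) * Wᴴ :=
    hτ'.conj (by rw [conjTranspose_conjTranspose, hWW])
  have hback : ∀ M : Matrix (Fin d) (Fin d) ℂ, Wᴴ * (Wᴴᴴ * M * Wᴴ) * W = M := by
    intro M
    calc _ = (Wᴴ * W) * M * (Wᴴ * W) := by
          simp only [conjTranspose_conjTranspose, Matrix.mul_assoc]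
      _ = M := by rw [hWW, Matrix.one_mul, Matrix.mul_one]
  have hsum := Finset.sum_le_sum fun α (_ : α ∈ Finset.univ) =>
    variance_bound_of_posSemidef hA hB h (hA.1 α) (hY.1 α)
  have hL : ∑ α, t * ∑ k, p k * (svar (ketBra (χ k)) (A α) +
      svar (ketBra (φ k)) (Wᴴᴴ * (-(Uᴴ * A α * U)ᵀ) * Wᴴ)) = t * (2 * (d - 1)) := by
    rw [← Finset.mul_sum, Finset.sum_comm]
    simp only [← Finset.mul_sum, Finset.sum_add_distrib, sum_svar_ketBra hA (hχ _),
      sum_svar_ketBra hY (hφ _), ← Finset.sum_mul, hp1]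
    ring
  have hR : ∑ α, svar (ketBra ψ) (A α ⊗ₖ (1 : Matrix (Fin d) (Fin d) ℂ) +
      (1 : Matrix (Fin d) (Fin d) ℂ) ⊗ₖ (Wᴴᴴ * (-(Uᴴ * A α * U)ᵀ) * Wᴴ)) ≤
      2 * d - 2 * (∑ i, s i) ^ 2 := by
    simp only [hs.svar_eq, hback]
    have hle : ∀ (ρ Z : Matrix (Fin d × Fin d) (Fin d × Fin d) ℂ), svar ρ Z ≤ mean ρ (Z * Z) :=
      fun ρ Z => sub_le_self _ (sq_nonneg _)
    refine (Finset.sum_le_sum fun α _ => hle _ _).trans (le_of_eq ?_)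
    simp only [mean_schmidtState_local_sq]
    rw [Finset.sum_add_distrib, ← Finset.mul_sum]
    have h1 : ∀ i, ∑ α, s i ^ 2 * (((Uᴴ * A α * U * (Uᴴ * A α * U)) i i).re +
        ((-(Uᴴ * A α * U)ᵀ * -(Uᴴ * A α * U)ᵀ) i i).re) = 2 * d * s i ^ 2 := by
      intro i
      have e1 := congrArg Complex.re (congrFun (congrFun hτ.sum_mul_self i) i)
      have e2 := congrArg Complex.re (congrFun (congrFun hτ'.sum_mul_self i) i)
      rw [Matrix.sum_apply, Complex.re_sum] at e1 e2
      rw [← Finset.mul_sum, Finset.sum_add_distrib, e1, e2]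
      simp
      ring
    have h2 : ∀ i, ∑ α, ∑ j, s i * s j * ((Uᴴ * A α * U) j i * (-(Uᴴ * A α * U)ᵀ) j i).re =
        ∑ j, -(s i * s j) := by
      intro i
      rw [Finset.sum_comm]
      refine Finset.sum_congr rfl fun j _ => ?_
      have e := congrArg Complex.re (hτ.sum_apply_mul_apply i j i j)
      rw [Complex.re_sum] at e
      simp only [and_self, if_true, Complex.one_re] at e
      rw [← Finset.mul_sum]
      simp only [Matrix.neg_apply, transpose_apply, mul_neg, Complex.neg_re, Finset.sum_neg_distrib, e]
      ring
    refine (congrArg₂ (fun x y => x + 2 * y)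
      (Finset.sum_comm.trans (Finset.sum_congr rfl fun i _ => h1 i))
      (Finset.sum_comm.trans (Finset.sum_congr rfl fun i _ => h2 i))).trans ?_
    rw [← Finset.mul_sum, hs.sum_sq hψ, sq, Finset.sum_mul_sum]
    simp only [Finset.sum_neg_distrib]
    ring
  rw [hL] at hsum
  linarith

end UpperBound

/-! ### Two-qubit pure states and the final assembly -/

theorem isState_ketBra {n : Type*} [Fintype n] {ψ : EuclideanSpace ℂ n} (h : ‖ψ‖ = 1) :
    IsState (ketBra ψ) :=
  ⟨ketBra_posSemidef ψ, trace_ketBra h⟩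

/-- For `d = 2` every feasible `t` is at most `2 - (s 0 + s 1) ^ 2 = 1 - 2 * (s 0 * s 1)`, and
normalisation makes the concurrence exactly `2 * (s 0 * s 1)`. -/
theorem pureConcurrence_le_entParam {A B : Fin (2 ^ 2) → Matrix (Fin 2) (Fin 2) ℂ}
    (hA : IsLOO A) (hB : IsLOO B) {ψ : Bipartite 2 2} (hψ : ‖ψ‖ = 1) :
    pureConcurrence ψ ≤ entParam A B (ketBra ψ) := by
  obtain ⟨s, U, W, h⟩ := exists_isSchmidt ψ
  have h1 := h.sum_sq hψ
  have hC : pureConcurrence ψ = 2 * (s 0 * s 1) := by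
    rw [pureConcurrence, h.purity_eq, ← Real.sqrt_mul (by norm_num)]
    rw [Fin.sum_univ_two] at h1 ⊢
    have e : ((2 : ℕ) : ℝ) / (((2 : ℕ) : ℝ) - 1) * (1 - (s 0 ^ 4 + s 1 ^ 4)) =
        (2 * (s 0 * s 1)) ^ 2 := by
      norm_num
      linear_combination (-2) * (1 + (s 0 ^ 2 + s 1 ^ 2)) * h1
    rw [e, Real.sqrt_sq (mul_nonneg zero_le_two (mul_nonneg (h.nonneg 0) (h.nonneg 1)))]
  rw [hC, entParam, le_sub_comm]
  refine csSup_le (feasibleSet_nonempty le_rfl hA hB (isState_ketBra hψ)) ?_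
  rintro t ⟨-, κA, κB, hκ, hpsd⟩
  have := le_of_posSemidef_schmidt hA hB hψ h hκ hpsd
  rw [Fin.sum_univ_two] at h1 this
  push_cast at this
  nlinarith

end CovEnt

theorem mainTheorem1 :
    -- two qubits
    (∀ A B : Fin (2 ^ 2) → Matrix (Fin 2) (Fin 2) ℂ, IsLOO A → IsLOO B →
      (∀ ψ : Bipartite 2 2, ‖ψ‖ = 1 → entParam A B (ketBra ψ) = pureConcurrence ψ) ∧
      (∀ ρ : Matrix (Fin 2 × Fin 2) (Fin 2 × Fin 2) ℂ, IsState ρ →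
        concurrence ρ ≥ entParam A B ρ)) ∧
    -- two qutrits
    (∀ A B : Fin (3 ^ 2) → Matrix (Fin 3) (Fin 3) ℂ, IsLOO A → IsLOO B →
      (∀ ψ : Bipartite 3 3, ‖ψ‖ = 1 → pureConcurrence ψ ≥ entParam A B (ketBra ψ) / 2) ∧
      (∀ ρ : Matrix (Fin 3 × Fin 3) (Fin 3 × Fin 3) ℂ, IsState ρ →
        concurrence ρ ≥ entParam A B ρ / 2 ∧
        concurrence ρ ≥ 1 / 4 * ((purity (reducedA ρ) + purity (reducedB ρ) - 2) / 2 +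
          √(1 / 4 * (purity (reducedA ρ) - purity (reducedB ρ)) ^ 2
            + traceNorm (corrBlock A B ρ) ^ 2)))) ∧
    -- `4 × 4` systems
    (∀ A B : Fin (4 ^ 2) → Matrix (Fin 4) (Fin 4) ℂ, IsLOO A → IsLOO B →
      (∀ ψ : Bipartite 4 4, ‖ψ‖ = 1 → pureConcurrence ψ ≥ entParam A B (ketBra ψ) / 3) ∧
      (∀ ρ : Matrix (Fin 4 × Fin 4) (Fin 4 × Fin 4) ℂ, IsState ρ →
        concurrence ρ ≥ entParam A B ρ / 3)) := by
  -- The factor is `c = d - 1`; the inequality is an equality for `d = 2` and strict for `d = 3, 4`.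
  have h2 : (((2 : ℕ) : ℝ) + 2) / 2 ≤ 1 ^ 2 * (((2 : ℕ) : ℝ) / (((2 : ℕ) : ℝ) - 1)) := by norm_num
  have h3 : (((3 : ℕ) : ℝ) + 2) / 2 ≤ 2 ^ 2 * (((3 : ℕ) : ℝ) / (((3 : ℕ) : ℝ) - 1)) := by norm_num
  have h4 : (((4 : ℕ) : ℝ) + 2) / 2 ≤ 3 ^ 2 * (((4 : ℕ) : ℝ) / (((4 : ℕ) : ℝ) - 1)) := by norm_num
  refine ⟨fun A B hA hB => ⟨fun ψ hψ => le_antisymm ?_ (pureConcurrence_le_entParam hA hB hψ),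
    fun ρ hρ => ?_⟩, fun A B hA hB => ⟨fun ψ hψ => ?_, fun ρ hρ => ?_⟩,
    fun A B hA hB => ⟨fun ψ hψ => ?_, fun ρ hρ => ?_⟩⟩
  · simpa using entParam_ketBra_le le_rfl hA hB h2 zero_le_one hψ
  · simpa using entParam_le_concurrence le_rfl hA hB h2 one_pos hρ
  · have := entParam_ketBra_le (by norm_num) hA hB h3 zero_le_two hψ
    linarith
  · have hE := entParam_le_concurrence (by norm_num) hA hB h3 two_pos hρ
    refine ⟨hE, ?_⟩
    -- The constant `1 / 4` combines `𝓔 / 2 ≤ C` with the factor `d - 1 = 2` in this bound.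
    have hN := le_entParam (by norm_num) hA hB hρ
    push_cast at hN
    linarith
  · have := entParam_ketBra_le (by norm_num) hA hB h4 zero_le_three hψ
    linarith
  · exact entParam_le_concurrence (by norm_num) hA hB h4 three_pos hρ
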